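/- Let $\Omega\subset\mathbb R^2$ be open, $\Omega=\Omega_1\cup\Gamma\cup\Omega_2$ with disjoint open sets $\Omega_1,\Omega_2$ and an interior interface $\Gamma=\partial\Omega_1\cap\partial\Omega_2$ that is a finite disjoint union of simple closed curves with regular $C^3$-parametrizations. Let $\kappa,C$ be constants. Then there is a constant $c$, depending only on $\Omega,\Omega_1,\Omega_2,\kappa,C$, such that the following holds. *Meshes.* Let $\mathcal T_P$ be a conforming mesh of $\Omega$ (so that $\Omega$ is the interior of the union of the patches) by finitely many closed convex quadrilaterals $P$ (patches), shape-regular with constant $\kappa$: each $P$ contains a disc of radius $\rho>0$ with $\operatorname{diam}P\le\kappa\rho$. Let $h_P=\max_P\operatorname{diam}P$. A patch is *cut* if $\Gamma$ meets its interior; assume that $\Gamma$ meets the boundary of every cut patch in exactly two points $a,b$, which are not on a common edge of the patch. Let $\mathcal T_h$ be a refinement in which every patch is split into four quadrilaterals or eight triangles, which are isoparametric of order two (injective $Q_2$- resp. $P_2$-images of the reference element), and let each element be assigned to one of the discrete subdomains $\Omega_h^1,\Omega_h^2$, where $\Omega_h^i$ is the interior of the union of the elements assigned to it. In a patch that is not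 cut, elements assigned to $\Omega_h^i$ lie in $\overline{\Omega_i}$; in a cut patch $P$, elements assigned to $\Omega_h^i$ meet $\partial P$ only in $\overline{\Omega_i}$, and the discrete interface in $P$ (the common points of the elements of $P$ assigned to $\Omega_h^1$ and those assigned to $\Omega_h^2$) is an edge from $a$ to $b$, or the union of an edge from $a$ to $x$ and one from $x$ to $b$ for some $x\in\Gamma\setminus\{a,b\}$. The interface approximation is quadratic in all cut patches except at most $n_l$ of them: each of these edges, with end points $y,z$, is the arc $t\mapsto(1-t)(1-2t)\,y+4t(1-t)\,m+t(2t-1)\,z$, $t\in[0,1]$, where the midnode $m\in\Gamma$ lies on the perpendicular bisector of $yz$. In the at most $n_l$ exceptional patches each edge may also be the straight segment $yz$ (linear approximation). *The function $\pi u$.* Let $u\in H^3(\Omega_1\cup\Omega_2)$, and let $\tilde u_1,\tilde u_2\in H^3(\Omega)$ be extensions of $u|_{\Omega_1},u|_{\Omega_2}$, i.e. $\tilde u_i=u$ a.e. on $\Omega_i$, with $\|\tilde u_i\|_{H^m(\Omega)}\le C\|u\|_{H^m(\Omega_i)}$ for $i=1,2$ and $m=2,3$. Let $\pi u=\tilde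 u_i$ on $\Omega_h^i$, $i=1,2$. *Conclusion.* $\pi u\in H^3(\Omega_h^1\cup\Omega_h^2)$, the function $u-\pi u$ is in $H^1$ of the open set $(\Omega_1\cup\Omega_2)\cap(\Omega_h^1\cup\Omega_h^2)$, and, with $\nabla(u-\pi u)$ taken piecewise, i.e. on this set, $$\|\nabla(u-\pi u)\|_{\Omega}\le c\,h_P\,(n_l^{1/2}+1)\,\|u\|_{H^2(\Omega_1\cup\Omega_2)},\qquad \|\nabla(u-\pi u)\|_{\Omega}\le c\,h_P^{3/2}\,(n_l^{1/2}+1)\,\|u\|_{H^3(\Omega_1\cup\Omega_2)}.$$ -/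

import Mathlib

open MeasureTheory Set
open scoped ContDiff

noncomputable section

namespace InterfaceFE

/-- The Euclidean plane. -/
abbrev Plane := EuclideanSpace ℝ (Fin 2)

/-! ### Sobolev spaces on open subsets of the plane -/

/-- `v` is the weak derivative `∂_{I 0} ⋯ ∂_{I (j-1)} u` on the open set `U`. -/
def HasWeakDeriv (U : Set Plane) {j : ℕ} (I : Fin j → Fin 2) (u v : Plane → ℝ) : Prop :=
  LocallyIntegrableOn u U ∧ LocallyIntegrableOn v U ∧
    ∀ φ : Plane → ℝ, ContDiff ℝ ∞ φ → HasCompactSupport φ → tsupport φ ⊆ U →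
      ∫ x in U, u x * iteratedFDeriv ℝ j φ x (fun l => EuclideanSpace.single (I l) (1 : ℝ)) =
        (-1) ^ j * ∫ x in U, v x * φ x

/-- `u ∈ H^k(U)`: all weak derivatives up to order `k` exist and are square integrable on `U`. -/
def MemSobolev (U : Set Plane) (k : ℕ) (u : Plane → ℝ) : Prop :=
  ∀ j ≤ k, ∀ I : Fin j → Fin 2,
    ∃ v, HasWeakDeriv U I u v ∧ MemLp v 2 (volume.restrict U)

open Classical in
/-- The weak derivative on `U` (unique up to null sets), and `0` if there is none. -/
def weakDeriv (U : Set Plane) {j : ℕ} (I : Fin j → Fin 2) (u : Plane → ℝ) : Plane → ℝ :=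
  if h : ∃ v, HasWeakDeriv U I u v then h.choose else 0

/-- The seminorm `‖∇^j u‖_U`, the `L²(U)` norm of the tensor of all `j`-th weak derivatives.
For `j = 1` this is `‖∇ u‖_U`. -/
def sobolevSeminorm (U : Set Plane) (j : ℕ) (u : Plane → ℝ) : ℝ :=
  √(∑ I : Fin j → Fin 2, (eLpNorm (weakDeriv U I u) 2 (volume.restrict U)).toReal ^ 2)

/-- The norm `‖u‖_{H^k(U)}`. -/
def sobolevNorm (U : Set Plane) (k : ℕ) (u : Plane → ℝ) : ℝ :=
  √(∑ j ∈ Finset.range (k + 1), sobolevSeminorm U j u ^ 2)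

/-! ### The domain and the interface

The two subdomains `Ω₁, Ω₂` are `Ωs 0, Ωs 1`. -/

/-- The interface `Γ = ∂Ω₁ ∩ ∂Ω₂`. -/
def interface (Ωs : Fin 2 → Set Plane) : Set Plane :=
  frontier (Ωs 0) ∩ frontier (Ωs 1)

/-- `Γ` is the union of finitely many disjoint simple closed curves, each with a regular
`C³`-parametrization of period `1`. -/
def HasC3Parametrization (Γ : Set Plane) : Prop :=
  ∃ (m : ℕ) (γ : Fin m → ℝ → Plane),
    (∀ i, ContDiff ℝ 3 (γ i)) ∧
    (∀ i t, deriv (γ i) t ≠ 0) ∧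
    (∀ i t, γ i (t + 1) = γ i t) ∧
    (∀ i j s t, γ i s = γ j t → i = j ∧ ∃ n : ℤ, t = s + n) ∧
    Γ = ⋃ i, range (γ i)

/-- `Ω = Ω₁ ∪ Γ ∪ Ω₂` with disjoint open sets `Ω₁, Ω₂` and the interior interface
`Γ = ∂Ω₁ ∩ ∂Ω₂` of class `C³`. -/
structure IsInterfaceSplitting (Ω : Set Plane) (Ωs : Fin 2 → Set Plane) : Prop where
  isOpen_domain : IsOpen Ω
  isOpen_sub : ∀ i, IsOpen (Ωs i)
  disjoint_sub : Disjoint (Ωs 0) (Ωs 1)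
  union_eq : Ω = Ωs 0 ∪ interface Ωs ∪ Ωs 1
  smooth : HasC3Parametrization (interface Ωs)

/-! ### The patch mesh -/

/-- The four points `q 0, q 1, q 2, q 3` are the vertices, in counterclockwise order, of a
convex quadrilateral: every three consecutive ones form a left turn. -/
def IsConvexQuad (q : Fin 4 → Plane) : Prop :=
  ∀ i, 0 < (q (i + 1) 0 - q i 0) * (q (i + 2) 1 - q i 1) -
    (q (i + 1) 1 - q i 1) * (q (i + 2) 0 - q i 0)

/-- A conforming mesh of `Ω` consisting of finitely many closed convex quadrilaterals. -/
structure PatchMesh (Ω : Set Plane) where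
  /-- the number of patches -/
  numPatches : ℕ
  /-- the four vertices of each patch -/
  vertex : Fin numPatches → Fin 4 → Plane
  convex : ∀ p, IsConvexQuad (vertex p)
  cover : Ω = interior (⋃ p, convexHull ℝ (range (vertex p)))
  interior_disjoint : ∀ p p', p ≠ p' →
    Disjoint (interior (convexHull ℝ (range (vertex p))))
      (interior (convexHull ℝ (range (vertex p'))))
  /-- two different patches meet in a common edge, in a common vertex, or not at all -/
  conforming : ∀ p p', p ≠ p' →
    convexHull ℝ (range (vertex p)) ∩ convexHull ℝ (range (vertex p')) =
      convexHull ℝ (range (vertex p) ∩ range (vertex p'))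

namespace PatchMesh

variable {Ω : Set Plane} (M : PatchMesh Ω)

/-- The closed patch `P`. -/
def patch (p : Fin M.numPatches) : Set Plane := convexHull ℝ (range (M.vertex p))

/-- The `i`-th closed edge of the patch. -/
def edge (p : Fin M.numPatches) (i : Fin 4) : Set Plane :=
  segment ℝ (M.vertex p i) (M.vertex p (i + 1))

/-- The mesh size `h_P`, the maximal diameter of a patch. -/
def meshSize : ℝ := ⨆ p, Metric.diam (M.patch p)

/-- Shape regularity with constant `κ`: the diameter of each patch is at most `κ` times the
radius of a disc contained in it. -/
def ShapeRegular (κ : ℝ) : Prop :=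
  ∀ p, ∃ (x : Plane) (ρ : ℝ), 0 < ρ ∧ Metric.closedBall x ρ ⊆ M.patch p ∧
    Metric.diam (M.patch p) ≤ κ * ρ

/-- The interface `Γ` cuts the patch if it passes through its interior. (A patch that is only
touched at its boundary, or one of whose edges matches the interface, counts as not cut.) -/
def IsCut (Γ : Set Plane) (p : Fin M.numPatches) : Prop :=
  (interior (M.patch p) ∩ Γ).Nonempty

/-- `Γ` meets the boundary of the patch in exactly the two points `a, b`, which do not lie on
the same edge. -/
def CutPoints (Γ : Set Plane) (p : Fin M.numPatches) (a b : Plane) : Prop :=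
  a ≠ b ∧ frontier (M.patch p) ∩ Γ = {a, b} ∧ ∀ i, ¬ (a ∈ M.edge p i ∧ b ∈ M.edge p i)

end PatchMesh

/-! ### Isoparametric elements -/

/-- The polynomial map of the plane with components `F 0, F 1`. -/
def polyMap (F : Fin 2 → MvPolynomial (Fin 2) ℝ) (x : Plane) : Plane :=
  WithLp.toLp 2 (fun i => MvPolynomial.eval (fun j => x j) (F i))

/-- The reference triangle. -/
def refTriangle : Set Plane := {x | 0 ≤ x 0 ∧ 0 ≤ x 1 ∧ x 0 + x 1 ≤ 1}

/-- The reference square. -/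
def refSquare : Set Plane := {x | ∀ i, 0 ≤ x i ∧ x i ≤ 1}

/-- An isoparametric triangle of order two: an injective `P₂`-image of the reference triangle. -/
def IsIsoTriangle (K : Set Plane) : Prop :=
  ∃ F : Fin 2 → MvPolynomial (Fin 2) ℝ, (∀ i, (F i).totalDegree ≤ 2) ∧
    InjOn (polyMap F) refTriangle ∧ K = polyMap F '' refTriangle

/-- An isoparametric quadrilateral of order two: an injective `Q₂`-image of the reference
square. -/
def IsIsoQuad (K : Set Plane) : Prop :=
  ∃ F : Fin 2 → MvPolynomial (Fin 2) ℝ, (∀ i j, (F i).degreeOf j ≤ 2) ∧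
    InjOn (polyMap F) refSquare ∧ K = polyMap F '' refSquare

/-! ### The discrete interface -/

/-- The quadratically parametrized arc through `a` (at `t = 0`), `m` (at `t = 1/2`) and `b`
(at `t = 1`). -/
def quadArc (a m b : Plane) : Set Plane :=
  (fun t : ℝ => ((1 - t) * (1 - 2 * t)) • a + (4 * t * (1 - t)) • m + (t * (2 * t - 1)) • b) ''
    Icc 0 1

/-- `E` is a discrete interface edge from `a` to `b` that approximates `Γ` with order two: the
edge node in the middle has been moved to `Γ` along the normal line through the midpoint of the
segment `ab`, that is, along its perpendicular bisector. -/
def IsQuadraticEdge (Γ : Set Plane) (a b : Plane) (E : Set Plane) : Prop :=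
  ∃ m ∈ Γ, dist m a = dist m b ∧ E = quadArc a m b

/-- `E` is a discrete interface edge from `a` to `b` that approximates `Γ` with order at least
`s`, `s ∈ {1, 2}`; a straight edge is an approximation of order one. -/
def IsInterfaceEdge (s : ℕ) (Γ : Set Plane) (a b : Plane) (E : Set Plane) : Prop :=
  IsQuadraticEdge Γ a b E ∨ (s = 1 ∧ E = segment ℝ a b)

/-- `G` is a discrete interface of order `s` from `a` to `b` within one patch: a single interface
edge, or two of them joined in a point `x` of `Γ` (the midpoint of the patch, moved to `Γ`). -/
def IsPatchInterface (s : ℕ) (Γ : Set Plane) (a b : Plane) (G : Set Plane) : Prop :=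
  IsInterfaceEdge s Γ a b G ∨
    ∃ x ∈ Γ, x ≠ a ∧ x ≠ b ∧ ∃ E₁ E₂, IsInterfaceEdge s Γ a x E₁ ∧ IsInterfaceEdge s Γ x b E₂ ∧
      G = E₁ ∪ E₂

/-- The refined mesh `T_h`. Every patch is split into four quadrilaterals or eight triangles;
`cells p i` is the set of those elements of the patch `p` which belong to the discrete subdomain
number `i`. -/
structure FittedMesh {Ω : Set Plane} (Ωs : Fin 2 → Set Plane) (M : PatchMesh Ω) where
  /-- the elements in the patch `p` that belong to the `i`-th discrete subdomain -/
  cells : Fin M.numPatches → Fin 2 → Finset (Set Plane)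
  /-- the patches in which the interface approximation may be only linear -/
  linear : Finset (Fin M.numPatches)
  cells_disjoint : ∀ p, Disjoint (cells p 0) (cells p 1)
  split : ∀ p,
    ((cells p 0).card + (cells p 1).card = 4 ∧ ∀ i, ∀ K ∈ cells p i, IsIsoQuad K) ∨
    ((cells p 0).card + (cells p 1).card = 8 ∧ ∀ i, ∀ K ∈ cells p i, IsIsoTriangle K)
  cover : ∀ p, ⋃ i, ⋃ K ∈ cells p i, K = M.patch p
  interior_disjoint : ∀ p i i', ∀ K ∈ cells p i, ∀ K' ∈ cells p i', K ≠ K' →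
    Disjoint (interior K) (interior K')
  /-- in a patch that is not cut, the elements lie in the subdomain they are assigned to -/
  not_cut : ∀ p, ¬ M.IsCut (interface Ωs) p → ∀ i, ∀ K ∈ cells p i, K ⊆ closure (Ωs i)
  /-- a patch that is cut is cut in exactly two boundary points `a, b`, not on the same edge, and
  the discrete interface in the patch joins `a` and `b`; its order is two, unless the patch is
  one of those with a linear approximation -/
  cut : ∀ p, M.IsCut (interface Ωs) p → ∃ a b, M.CutPoints (interface Ωs) p a b ∧
    IsPatchInterface (if p ∈ linear then 1 else 2) (interface Ωs) a b
      ((⋃ K ∈ cells p 0, K) ∩ (⋃ K ∈ cells p 1, K))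
  /-- the edges of a patch are cut at `a` and `b` precisely, so that on the boundary of the patch
  the discrete subdomains agree with the exact ones -/
  boundary : ∀ p, M.IsCut (interface Ωs) p → ∀ i, ∀ K ∈ cells p i,
    K ∩ frontier (M.patch p) ⊆ closure (Ωs i)

namespace FittedMesh

variable {Ω : Set Plane} {Ωs : Fin 2 → Set Plane} {M : PatchMesh Ω} (T : FittedMesh Ωs M)

/-- The discrete subdomain `Ω_h^i`. -/
def sub (i : Fin 2) : Set Plane := interior (⋃ p, ⋃ K ∈ T.cells p i, K)

open Classical in
/-- The function `πu` that equals the extension `ũ i` on `Ω_h^i`. (Its values on the discrete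
interface, a null set, are immaterial.) -/
def proj (ut : Fin 2 → Plane → ℝ) : Plane → ℝ :=
  fun x => if x ∈ T.sub 0 then ut 0 x else ut 1 x

/-- `Ω` without the interface `Γ` and without the discrete interface `Γ_h`; the gradient of
`u - πu` is taken piecewise, that is, on this open set. -/
def brokenDomain : Set Plane := (Ωs 0 ∪ Ωs 1) ∩ (T.sub 0 ∪ T.sub 1)

end FittedMesh

/-- `ut 0, ut 1 ∈ H³(Ω)` are extensions of `u|_{Ω₁}, u|_{Ω₂}` to `Ω`, bounded in the `H²`- and in
the `H³`-norm with the constant `C`. -/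
structure IsExtension (Ω : Set Plane) (Ωs : Fin 2 → Set Plane) (C : ℝ) (u : Plane → ℝ)
    (ut : Fin 2 → Plane → ℝ) : Prop where
  mem : ∀ i, MemSobolev Ω 3 (ut i)
  eq : ∀ i, ∀ᵐ x ∂(volume.restrict (Ωs i)), ut i x = u x
  bound : ∀ i, ∀ m : ℕ, m = 2 ∨ m = 3 →
    sobolevNorm Ω m (ut i) ≤ C * sobolevNorm (Ωs i) m u

end InterfaceFE

end

/-! On `Ωs i ∩ T.sub i` both `u` and `πu` equal `ũ_i`, so nothing is left there. On `Ωs i ∩ T.sub k`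
with `i ≠ k` the error is `ũ_i - ũ_k`. Hence the squared gradient norm is at most a constant times
the integrals of `|∇ũ_i|²` over the set `mismatch`, where exact and discrete subdomains disagree
(`sqInt_weakDeriv_sub_proj_le`). Two facts bound these integrals.

Geometry. Near each of its points `Γ` lies on a `C³` graph over a coordinate axis
(`exists_isGraphChart`). Within a chart the discrete interface has distance `O(h²)` from the graph
for linear edges and `O(h³)` for quadratic ones (`exists_edge_bound`); the cubic order relies on the
midnode lying on the perpendicular bisector, which puts it within `O(h²)` of the middle of the
chord. A mismatch point is no farther from the graph than the discrete interface is (`mem_strip`):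
walking away from the graph, one would otherwise reach the boundary of the patch without meeting
either interface, although the two partitions agree on that boundary.

Traces. Let `A` lie in a box and have slices of length at most `δ` in direction `j`. The embedding
of `H¹` in `L^∞` on lines gives `∫_A v² ≤ K δ (‖v‖² + ‖∂_j v‖²)`. If moreover `A` has width `h` in
direction `i`, the embedding is used in both directions and yields a factor `δ h`, at the price of
the mixed second derivative of `v`.

With `v = ∂ũ_i` and `δ = O(h²)` the squared error is `O(h²)` in terms of the `H²` norm. For the `H³`
norm the quadratic patches give `δ = O(h³)`, while each of the at most `n_l` linear patches gives `δ
h = O(h³)`; together `O((n_l + 1) h³)`. Finitely many charts suffice by compactness. This settles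
small `h`, and for large `h` the estimate is trivial. -/

noncomputable section

namespace InterfaceFE

/-! ### Weak derivatives -/

/-- The classical derivative `∂_{I 0} ⋯ ∂_{I (j-1)} φ`. -/
abbrev partialDeriv {j : ℕ} (I : Fin j → Fin 2) (φ : Plane → ℝ) (x : Plane) : ℝ :=
  iteratedFDeriv ℝ j φ x (fun l => EuclideanSpace.single (I l) (1 : ℝ))

lemma continuous_partialDeriv {j : ℕ} (I : Fin j → Fin 2) {φ : Plane → ℝ}
    (hφ : ContDiff ℝ ∞ φ) : Continuous (partialDeriv I φ) := by
  have := hφ.continuous_iteratedFDeriv (m := j) (by exact_mod_cast le_top)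
  unfold partialDeriv
  fun_prop

lemma support_partialDeriv_subset {j : ℕ} (I : Fin j → Fin 2) (φ : Plane → ℝ) :
    Function.support (partialDeriv I φ) ⊆ tsupport φ := by
  intro x hx
  apply support_iteratedFDeriv_subset (𝕜 := ℝ) j
  intro h
  exact hx (by simp [partialDeriv, h])

lemma partialDeriv_eq_zero {j : ℕ} (I : Fin j → Fin 2) {φ : Plane → ℝ} {x : Plane}
    (hx : x ∉ tsupport φ) : partialDeriv I φ x = 0 := by
  by_contra h
  exact hx (support_partialDeriv_subset I φ h)

lemma tsupport_partialDeriv_subset {j : ℕ} (I : Fin j → Fin 2) (φ : Plane → ℝ) :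
    tsupport (partialDeriv I φ) ⊆ tsupport φ :=
  closure_minimal (support_partialDeriv_subset I φ) (isClosed_tsupport φ)

lemma hasCompactSupport_partialDeriv {j : ℕ} (I : Fin j → Fin 2) {φ : Plane → ℝ}
    (hφ : HasCompactSupport φ) : HasCompactSupport (partialDeriv I φ) :=
  hφ.of_isClosed_subset (isClosed_tsupport _) (tsupport_partialDeriv_subset I φ)

lemma integrableOn_mul_of_hasCompactSupport {U : Set Plane} {u φ : Plane → ℝ}
    (hu : LocallyIntegrableOn u U) (hφ : Continuous φ) (hc : HasCompactSupport φ)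
    (hs : tsupport φ ⊆ U) : Integrable (fun x => u x * φ x) := by
  have h1 : IntegrableOn u (tsupport φ) := hu.integrableOn_compact_subset hs hc
  have h2 : IntegrableOn (fun x => u x * φ x) (tsupport φ) :=
    h1.mul_continuousOn hφ.continuousOn hc
  rwa [integrableOn_iff_integrable_of_support_subset] at h2
  intro x hx
  exact subset_tsupport _ (right_ne_zero_of_mul hx)

lemma setIntegral_mul_eq {U : Set Plane} {u φ : Plane → ℝ}
    (hs : tsupport φ ⊆ U) : ∫ x in U, u x * φ x = ∫ x, u x * φ x := by
  apply setIntegral_eq_integral_of_forall_compl_eq_zero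
  intro x hx
  rw [image_eq_zero_of_notMem_tsupport (fun h => hx (hs h)), mul_zero]

lemma HasWeakDeriv.integral_eq {U : Set Plane} {j : ℕ} {I : Fin j → Fin 2} {u v : Plane → ℝ}
    (h : HasWeakDeriv U I u v) {φ : Plane → ℝ} (h1 : ContDiff ℝ ∞ φ) (h2 : HasCompactSupport φ)
    (h3 : tsupport φ ⊆ U) :
    ∫ x, u x * partialDeriv I φ x = (-1) ^ j * ∫ x, v x * φ x := by
  have := h.2.2 φ h1 h2 h3
  rwa [setIntegral_mul_eq h3,
    setIntegral_mul_eq (φ := partialDeriv I φ) ((tsupport_partialDeriv_subset I φ).trans h3)]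
    at this

/-- Test functions vanish off `U`, so all integrals may be taken over the plane. In this form the
set only enters through the class of test functions, and restriction to a smaller set is immediate.
-/
lemma hasWeakDeriv_iff {U : Set Plane} {j : ℕ} {I : Fin j → Fin 2} {u v : Plane → ℝ} :
    HasWeakDeriv U I u v ↔ LocallyIntegrableOn u U ∧ LocallyIntegrableOn v U ∧
      ∀ φ : Plane → ℝ, ContDiff ℝ ∞ φ → HasCompactSupport φ → tsupport φ ⊆ U →
        ∫ x, u x * partialDeriv I φ x = (-1) ^ j * ∫ x, v x * φ x := by
  refine ⟨fun h => ⟨h.1, h.2.1, fun φ h1 h2 h3 => h.integral_eq h1 h2 h3⟩,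
    fun h => ⟨h.1, h.2.1, fun φ h1 h2 h3 => ?_⟩⟩
  rw [setIntegral_mul_eq h3,
    setIntegral_mul_eq (φ := partialDeriv I φ) ((tsupport_partialDeriv_subset I φ).trans h3)]
  exact h.2.2 φ h1 h2 h3

lemma HasWeakDeriv.mono {U V : Set Plane} {j : ℕ} {I : Fin j → Fin 2} {u v : Plane → ℝ}
    (h : HasWeakDeriv U I u v) (hVU : V ⊆ U) : HasWeakDeriv V I u v :=
  hasWeakDeriv_iff.2 ⟨h.1.mono_set hVU, h.2.1.mono_set hVU,
    fun _ h1 h2 h3 => h.integral_eq h1 h2 (h3.trans hVU)⟩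

lemma HasWeakDeriv.congr {U : Set Plane} {j : ℕ} {I : Fin j → Fin 2} {u v u' v' : Plane → ℝ}
    (h : HasWeakDeriv U I u v) (hu : u =ᵐ[volume.restrict U] u')
    (hv : v =ᵐ[volume.restrict U] v') : HasWeakDeriv U I u' v' := by
  refine ⟨h.1.congr hu, h.2.1.congr hv, fun φ h1 h2 h3 => ?_⟩
  have e1 : ∫ x in U, u' x * partialDeriv I φ x = ∫ x in U, u x * partialDeriv I φ x :=
    integral_congr_ae (by filter_upwards [hu] with x hx; rw [hx])
  have e2 : ∫ x in U, v' x * φ x = ∫ x in U, v x * φ x :=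
    integral_congr_ae (by filter_upwards [hv] with x hx; rw [hx])
  rw [e1, e2]
  exact h.2.2 φ h1 h2 h3

lemma HasWeakDeriv.sub {U : Set Plane} {j : ℕ} {I : Fin j → Fin 2} {u v u' v' : Plane → ℝ}
    (h : HasWeakDeriv U I u v) (h' : HasWeakDeriv U I u' v') :
    HasWeakDeriv U I (u - u') (v - v') := by
  refine hasWeakDeriv_iff.2 ⟨h.1.sub h'.1, h.2.1.sub h'.2.1, fun φ h1 h2 h3 => ?_⟩
  have hD := (tsupport_partialDeriv_subset I φ).trans h3
  have cD := continuous_partialDeriv I h1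
  have sD := hasCompactSupport_partialDeriv I h2
  simp only [Pi.sub_apply, sub_mul]
  rw [integral_sub (integrableOn_mul_of_hasCompactSupport h.1 cD sD hD)
      (integrableOn_mul_of_hasCompactSupport h'.1 cD sD hD),
    integral_sub (integrableOn_mul_of_hasCompactSupport h.2.1 h1.continuous h2 h3)
      (integrableOn_mul_of_hasCompactSupport h'.2.1 h1.continuous h2 h3),
    h.integral_eq h1 h2 h3, h'.integral_eq h1 h2 h3, mul_sub]

lemma HasWeakDeriv.unique {U : Set Plane} (hU : IsOpen U) {j : ℕ} {I : Fin j → Fin 2}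
    {u v w : Plane → ℝ} (hv : HasWeakDeriv U I u v) (hw : HasWeakDeriv U I u w) :
    v =ᵐ[volume.restrict U] w := by
  have := hU.ae_eq_zero_of_integral_contDiff_smul_eq_zero (μ := volume) (f := v - w)
    (hv.2.1.sub hw.2.1) (fun φ h1 h2 h3 => by
      have a := hv.integral_eq h1 h2 h3
      rw [hw.integral_eq h1 h2 h3] at a
      have b := mul_left_cancel₀ (pow_ne_zero _ (by norm_num)) a
      simp only [Pi.sub_apply, smul_eq_mul, mul_comm (φ _), sub_mul]
      rw [integral_sub (integrableOn_mul_of_hasCompactSupport hv.2.1 h1.continuous h2 h3)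
        (integrableOn_mul_of_hasCompactSupport hw.2.1 h1.continuous h2 h3), b, sub_self])
  rw [Filter.EventuallyEq, ae_restrict_iff' hU.measurableSet]
  filter_upwards [this] with x hx hxU
  exact sub_eq_zero.1 (hx hxU)

lemma partialDeriv_congr {j : ℕ} (I : Fin j → Fin 2) {φ ψ : Plane → ℝ} {U : Set Plane}
    (hU : IsOpen U) (h : EqOn φ ψ U) {x : Plane} (hx : x ∈ U) :
    partialDeriv I φ x = partialDeriv I ψ x := by
  have : φ =ᶠ[nhds x] ψ := Filter.eventuallyEq_of_mem (hU.mem_nhds hx) h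
  simp only [partialDeriv, (this.iteratedFDeriv ℝ j).eq_of_nhds]

/-- A test function supported in the union of two disjoint open sets splits. -/
lemma contDiff_indicator_of_tsupport_subset {U V : Set Plane} (hU : IsOpen U) (hV : IsOpen V)
    (hUV : Disjoint U V) {φ : Plane → ℝ} (h1 : ContDiff ℝ ∞ φ) (h3 : tsupport φ ⊆ U ∪ V) :
    ContDiff ℝ ∞ (U.indicator φ) ∧ tsupport (U.indicator φ) ⊆ U := by
  constructor
  · rw [contDiff_iff_contDiffAt]
    intro x
    by_cases hx : x ∈ tsupport φ
    · rcases h3 hx with hxU | hxV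
      · exact h1.contDiffAt.congr_of_eventuallyEq
          (Filter.eventuallyEq_of_mem (hU.mem_nhds hxU) (fun y hy => indicator_of_mem hy φ))
      · refine (contDiffAt_const (c := (0 : ℝ))).congr_of_eventuallyEq
          (Filter.eventuallyEq_of_mem (hV.mem_nhds hxV) (fun y hy => ?_))
        exact indicator_of_notMem (fun h => hUV.le_bot ⟨h, hy⟩) φ
    · refine (contDiffAt_const (c := (0 : ℝ))).congr_of_eventuallyEq
        (Filter.eventuallyEq_of_mem ((isClosed_tsupport φ).isOpen_compl.mem_nhds hx)
          (fun y hy => ?_))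
      exact indicator_apply_eq_zero.2 fun _ => image_eq_zero_of_notMem_tsupport hy
  · intro x hx
    have hs : Function.support (U.indicator φ) ⊆ tsupport φ ∩ U := by
      rw [support_indicator]
      exact fun y hy => ⟨subset_tsupport _ hy.2, hy.1⟩
    have h4 : x ∈ tsupport φ :=
      closure_minimal (hs.trans inter_subset_left) (isClosed_tsupport φ) hx
    have h5 : x ∈ closure U := closure_mono (hs.trans inter_subset_right) hx
    rcases h3 h4 with h | h
    · exact h
    · exact absurd h ((hUV.closure_left hV).le_bot ⟨h5, ·⟩)

lemma LocallyIntegrableOn.union_of_isOpen {U V : Set Plane} (hU : IsOpen U) (hV : IsOpen V)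
    {u : Plane → ℝ} (h1 : LocallyIntegrableOn u U) (h2 : LocallyIntegrableOn u V) :
    LocallyIntegrableOn u (U ∪ V) := by
  rintro x (hx | hx)
  · obtain ⟨t, ht, h⟩ := h1 x hx
    refine ⟨t, nhdsWithin_le_nhds ?_, h⟩
    rwa [hU.nhdsWithin_eq hx] at ht
  · obtain ⟨t, ht, h⟩ := h2 x hx
    refine ⟨t, nhdsWithin_le_nhds ?_, h⟩
    rwa [hV.nhdsWithin_eq hx] at ht

/-- Since the sets are open and disjoint, multiplying a test function by the indicator of one of
them keeps it smooth; the identity on the union is the sum of the identities on the two parts. -/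
lemma HasWeakDeriv.union {U V : Set Plane} (hU : IsOpen U) (hV : IsOpen V) (hUV : Disjoint U V)
    {j : ℕ} {I : Fin j → Fin 2} {u v : Plane → ℝ} (h : HasWeakDeriv U I u v)
    (h' : HasWeakDeriv V I u v) : HasWeakDeriv (U ∪ V) I u v := by
  have hu := LocallyIntegrableOn.union_of_isOpen hU hV h.1 h'.1
  have hv := LocallyIntegrableOn.union_of_isOpen hU hV h.2.1 h'.2.1
  refine ⟨hu, hv, fun φ h1 h2 h3 => ?_⟩
  have key : ∀ W W' : Set Plane, IsOpen W → IsOpen W' → Disjoint W W' → tsupport φ ⊆ W ∪ W' →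
      HasWeakDeriv W I u v →
      ∫ x in W, u x * partialDeriv I φ x = (-1) ^ j * ∫ x in W, v x * φ x := by
    intro W W' hW hW' hWW hs hd
    obtain ⟨c1, c2⟩ := contDiff_indicator_of_tsupport_subset hW hW' hWW h1 hs
    have c3 : HasCompactSupport (W.indicator φ) := by
      refine h2.of_isClosed_subset (isClosed_tsupport _) (closure_mono ?_)
      rw [support_indicator]
      exact inter_subset_right
    have := hd.2.2 _ c1 c3 c2
    have e : EqOn (W.indicator φ) φ W := fun y hy => indicator_of_mem hy φ
    have e1 : ∫ x in W, u x * partialDeriv I φ x =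
        ∫ x in W, u x * partialDeriv I (W.indicator φ) x :=
      setIntegral_congr_fun hW.measurableSet fun x hx => by
        simp only [partialDeriv_congr I hW e hx]
    have e2 : ∫ x in W, v x * φ x = ∫ x in W, v x * W.indicator φ x :=
      setIntegral_congr_fun hW.measurableSet fun x hx => by simp only [e hx]
    rw [e1, e2]
    exact this
  have hD := (tsupport_partialDeriv_subset I φ).trans h3
  have i1 := integrableOn_mul_of_hasCompactSupport hu (continuous_partialDeriv I h1)
    (hasCompactSupport_partialDeriv I h2) hD
  have i2 := integrableOn_mul_of_hasCompactSupport hv h1.continuous h2 h3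
  change ∫ x in U ∪ V, u x * partialDeriv I φ x = _
  rw [setIntegral_union hUV hV.measurableSet i1.integrableOn i1.integrableOn,
    setIntegral_union hUV hV.measurableSet i2.integrableOn i2.integrableOn,
    key U V hU hV hUV h3 h, key V U hV hU hUV.symm (by rwa [union_comm]) h', mul_add]

/-! ### Sobolev functions -/

lemma MemSobolev.hasWeakDeriv {U : Set Plane} {k : ℕ} {u : Plane → ℝ} (h : MemSobolev U k u)
    {j : ℕ} (hj : j ≤ k) (I : Fin j → Fin 2) : HasWeakDeriv U I u (weakDeriv U I u) := by
  obtain ⟨v, hv, -⟩ := h j hj I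
  have : ∃ v, HasWeakDeriv U I u v := ⟨v, hv⟩
  rw [weakDeriv, dif_pos this]
  exact this.choose_spec

lemma HasWeakDeriv.weakDeriv_ae_eq {U : Set Plane} (hU : IsOpen U) {j : ℕ} {I : Fin j → Fin 2}
    {u v : Plane → ℝ} (h : HasWeakDeriv U I u v) : weakDeriv U I u =ᵐ[volume.restrict U] v := by
  have : ∃ v, HasWeakDeriv U I u v := ⟨v, h⟩
  rw [weakDeriv, dif_pos this]
  exact this.choose_spec.unique hU h

lemma MemSobolev.memLp {U : Set Plane} (hU : IsOpen U) {k : ℕ} {u : Plane → ℝ}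
    (h : MemSobolev U k u) {j : ℕ} (hj : j ≤ k) (I : Fin j → Fin 2) :
    MemLp (weakDeriv U I u) 2 (volume.restrict U) := by
  obtain ⟨v, hv, hm⟩ := h j hj I
  exact hm.ae_eq (hv.weakDeriv_ae_eq hU).symm

lemma MemSobolev.mono {U V : Set Plane} {k l : ℕ} {u : Plane → ℝ}
    (h : MemSobolev U k u) (hVU : V ⊆ U) (hl : l ≤ k) : MemSobolev V l u := fun j hj I =>
  let ⟨v, hv, hm⟩ := h j (hj.trans hl) I
  ⟨v, hv.mono hVU, hm.mono_measure (Measure.restrict_mono hVU le_rfl)⟩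

lemma MemSobolev.congr {U : Set Plane} {k : ℕ} {u u' : Plane → ℝ} (h : MemSobolev U k u)
    (hu : u =ᵐ[volume.restrict U] u') : MemSobolev U k u' := fun j hj I =>
  let ⟨v, hv, hm⟩ := h j hj I
  ⟨v, hv.congr hu Filter.EventuallyEq.rfl, hm⟩

lemma MemSobolev.sub {U : Set Plane} {k : ℕ} {u u' : Plane → ℝ} (h : MemSobolev U k u)
    (h' : MemSobolev U k u') : MemSobolev U k (u - u') := fun j hj I =>
  let ⟨v, hv, hm⟩ := h j hj I
  let ⟨v', hv', hm'⟩ := h' j hj I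
  ⟨v - v', hv.sub hv', hm.sub hm'⟩

lemma MemSobolev.union {U V : Set Plane} (hU : IsOpen U) (hV : IsOpen V) (hUV : Disjoint U V)
    {k : ℕ} {u : Plane → ℝ} (h : MemSobolev U k u) (h' : MemSobolev V k u) :
    MemSobolev (U ∪ V) k u := by
  intro j hj I
  obtain ⟨v, hv, hm⟩ := h j hj I
  obtain ⟨v', hv', hm'⟩ := h' j hj I
  set f := U.indicator v + V.indicator v' with hf
  have e1 : v =ᵐ[volume.restrict U] f :=
    (ae_restrict_iff' hU.measurableSet).2 (Filter.Eventually.of_forall fun x hx => by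
      have : x ∉ V := fun h => hUV.le_bot ⟨hx, h⟩
      simp [hf, hx, this])
  have e2 : v' =ᵐ[volume.restrict V] f :=
    (ae_restrict_iff' hV.measurableSet).2 (Filter.Eventually.of_forall fun x hx => by
      have : x ∉ U := fun h => hUV.le_bot ⟨h, hx⟩
      simp [hf, hx, this])
  refine ⟨f, (hv.congr .rfl e1).union hU hV hUV (hv'.congr .rfl e2), ?_⟩
  exact (((memLp_indicator_iff_restrict hU.measurableSet).2 hm).add
    ((memLp_indicator_iff_restrict hV.measurableSet).2 hm')).restrict _

/-- The square integral `∫_A |f|²`, as an extended nonnegative number. -/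
def sqInt (A : Set Plane) (f : Plane → ℝ) : ENNReal := ∫⁻ x in A, ‖f x‖ₑ ^ 2

lemma eLpNorm_sq_eq_sqInt (A : Set Plane) (f : Plane → ℝ) :
    eLpNorm f 2 (volume.restrict A) ^ 2 = sqInt A f := by
  have := eLpNorm_nnreal_pow_eq_lintegral (f := f) (μ := volume.restrict A) (p := 2) (by norm_num)
  simpa [sqInt] using this

lemma sqInt_mono {A B : Set Plane} (h : A ⊆ B) (f : Plane → ℝ) : sqInt A f ≤ sqInt B f :=
  lintegral_mono_set h

lemma sqInt_congr {A : Set Plane} {f g : Plane → ℝ} (h : f =ᵐ[volume.restrict A] g) :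
    sqInt A f = sqInt A g :=
  lintegral_congr_ae (by filter_upwards [h] with x hx; rw [hx])

lemma sqInt_sub_le (A : Set Plane) {f g : Plane → ℝ}
    (hf : AEStronglyMeasurable f (volume.restrict A)) :
    sqInt A (f - g) ≤ 2 * (sqInt A f + sqInt A g) := by
  unfold sqInt
  rw [← lintegral_add_left' (hf.enorm.pow_const 2),
    ← lintegral_const_mul' _ _ (by simp)]
  refine lintegral_mono fun x => ?_
  have h1 : ‖(f - g) x‖ₑ ≤ ‖f x‖ₑ + ‖g x‖ₑ := enorm_sub_le
  calc ‖(f - g) x‖ₑ ^ 2 ≤ (‖f x‖ₑ + ‖g x‖ₑ) ^ 2 := by gcongr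
    _ ≤ 2 * (‖f x‖ₑ ^ 2 + ‖g x‖ₑ ^ 2) := by
      have := ENNReal.rpow_add_le_mul_rpow_add_rpow ‖f x‖ₑ ‖g x‖ₑ (p := 2) (by norm_num)
      norm_num at this
      exact this

lemma sobolevSeminorm_nonneg (U : Set Plane) (j : ℕ) (u : Plane → ℝ) :
    0 ≤ sobolevSeminorm U j u := Real.sqrt_nonneg _

lemma sobolevNorm_nonneg (U : Set Plane) (k : ℕ) (u : Plane → ℝ) :
    0 ≤ sobolevNorm U k u := Real.sqrt_nonneg _

/-- Membership makes the `L²` norms finite, so that `toReal` loses nothing. From here on all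
estimates can be made in `ENNReal`, without integrability side conditions. -/
lemma MemSobolev.ofReal_sobolevSeminorm_sq {U : Set Plane} (hU : IsOpen U) {k : ℕ}
    {u : Plane → ℝ} (h : MemSobolev U k u) {j : ℕ} (hj : j ≤ k) :
    ENNReal.ofReal (sobolevSeminorm U j u ^ 2) =
      ∑ I : Fin j → Fin 2, sqInt U (weakDeriv U I u) := by
  rw [sobolevSeminorm, Real.sq_sqrt (by positivity),
    ENNReal.ofReal_sum_of_nonneg (fun _ _ => by positivity)]
  refine Finset.sum_congr rfl fun I _ => ?_
  rw [ENNReal.ofReal_pow ENNReal.toReal_nonneg, ENNReal.ofReal_toReal (h.memLp hU hj I).2.ne,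
    eLpNorm_sq_eq_sqInt]

lemma sobolevSeminorm_le_sobolevNorm (U : Set Plane) {j k : ℕ} (hj : j ≤ k) (u : Plane → ℝ) :
    sobolevSeminorm U j u ≤ sobolevNorm U k u := by
  refine Real.le_sqrt_of_sq_le ?_
  exact Finset.single_le_sum (f := fun j => sobolevSeminorm U j u ^ 2) (fun _ _ => by positivity)
    (Finset.mem_range.2 (Nat.lt_succ_of_le hj))

lemma sobolevNorm_mono (U : Set Plane) {l k : ℕ} (hl : l ≤ k) (u : Plane → ℝ) :
    sobolevNorm U l u ≤ sobolevNorm U k u := by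
  refine Real.sqrt_le_sqrt (Finset.sum_le_sum_of_subset_of_nonneg ?_ fun _ _ _ => by positivity)
  exact Finset.range_mono (by lia)

lemma MemSobolev.sqInt_le {U : Set Plane} (hU : IsOpen U) {k l : ℕ}
    {u : Plane → ℝ} (h : MemSobolev U k u) {j : ℕ} (hj : j ≤ l) (hl : l ≤ k) (I : Fin j → Fin 2) :
    sqInt U (weakDeriv U I u) ≤ ENNReal.ofReal (sobolevNorm U l u ^ 2) := by
  calc sqInt U (weakDeriv U I u) ≤ ∑ I : Fin j → Fin 2, sqInt U (weakDeriv U I u) :=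
        Finset.single_le_sum (f := fun I => sqInt U (weakDeriv U I u)) (fun _ _ => zero_le)
          (Finset.mem_univ I)
    _ = ENNReal.ofReal (sobolevSeminorm U j u ^ 2) :=
        (h.ofReal_sobolevSeminorm_sq hU (hj.trans hl)).symm
    _ ≤ _ := by
        gcongr
        exacts [sobolevSeminorm_nonneg _ _ _, sobolevSeminorm_le_sobolevNorm U hj u]

lemma MemSobolev.sobolevNorm_mono_set {U V : Set Plane} (hU : IsOpen U) (hV : IsOpen V)
    (hVU : V ⊆ U) {k : ℕ} {u : Plane → ℝ} (h : MemSobolev U k u) :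
    sobolevNorm V k u ≤ sobolevNorm U k u := by
  refine Real.sqrt_le_sqrt (Finset.sum_le_sum fun j hj => ?_)
  have hj : j ≤ k := Nat.lt_succ_iff.1 (Finset.mem_range.1 hj)
  have h' := h.mono hVU le_rfl
  rw [← ENNReal.ofReal_le_ofReal_iff (by positivity), h.ofReal_sobolevSeminorm_sq hU hj,
    h'.ofReal_sobolevSeminorm_sq hV hj]
  refine Finset.sum_le_sum fun I _ => ?_
  rw [sqInt_congr (((h.hasWeakDeriv hj I).mono hVU).weakDeriv_ae_eq hV)]
  exact sqInt_mono hVU _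

/-! ### First order weak derivatives -/

/-- `w` is the weak first order derivative `∂_l v` on `U`. -/
abbrev HasWeakPartial (U : Set Plane) (l : Fin 2) (v w : Plane → ℝ) : Prop :=
  HasWeakDeriv U (fun _ : Fin 1 => l) v w

lemma partialDeriv_one (l : Fin 2) (φ : Plane → ℝ) (x : Plane) :
    partialDeriv (fun _ : Fin 1 => l) φ x = fderiv ℝ φ x (EuclideanSpace.single l 1) := by
  simp [partialDeriv]

lemma contDiff_partialDeriv_one (l : Fin 2) {φ : Plane → ℝ} (hφ : ContDiff ℝ ∞ φ) :
    ContDiff ℝ ∞ (partialDeriv (fun _ : Fin 1 => l) φ) := by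
  have : partialDeriv (fun _ : Fin 1 => l) φ =
      fun x => fderiv ℝ φ x (EuclideanSpace.single l 1) := funext (partialDeriv_one l φ)
  rw [this]
  exact (hφ.fderiv_right (m := ∞) (by simp)).clm_apply contDiff_const

lemma partialDeriv_snoc {j : ℕ} (I : Fin j → Fin 2) (l : Fin 2) {φ : Plane → ℝ}
    (hφ : ContDiff ℝ ∞ φ) (x : Plane) :
    partialDeriv (Fin.snoc I l : Fin (j + 1) → Fin 2) φ x =
      partialDeriv I (partialDeriv (fun _ : Fin 1 => l) φ) x := by
  have : partialDeriv (fun _ : Fin 1 => l) φ =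
      (ContinuousLinearMap.apply ℝ ℝ (EuclideanSpace.single l (1 : ℝ) : Plane)) ∘ fderiv ℝ φ :=
    funext (partialDeriv_one l φ)
  rw [this]
  unfold partialDeriv
  rw [iteratedFDeriv_succ_apply_right, ContinuousLinearMap.iteratedFDeriv_comp_left _
    (hφ.fderiv_right (m := ∞) (by simp)).contDiffAt (by exact_mod_cast le_top)]
  simp [Fin.init_def]

/-- Test the identity for `v` with `∂_l φ` and compare it with the identity for `w`. In this way the
trace estimates, which concern first derivatives, apply to `v = ∂ũ_i` and to `v = ∂²ũ_i`. -/
lemma HasWeakDeriv.hasWeakPartial {U : Set Plane} {j : ℕ} {I : Fin j → Fin 2} {l : Fin 2}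
    {u v w : Plane → ℝ} (hv : HasWeakDeriv U I u v)
    (hw : HasWeakDeriv U (Fin.snoc I l : Fin (j + 1) → Fin 2) u w) : HasWeakPartial U l v w := by
  refine hasWeakDeriv_iff.2 ⟨hv.2.1, hw.2.1, fun φ h1 h2 h3 => ?_⟩
  have a := hv.integral_eq (contDiff_partialDeriv_one l h1) (hasCompactSupport_partialDeriv _ h2)
    ((tsupport_partialDeriv_subset _ _).trans h3)
  have b := hw.integral_eq h1 h2 h3
  simp only [partialDeriv_snoc I l h1] at b
  rw [b, pow_succ, mul_assoc] at a
  simpa using (mul_left_cancel₀ (pow_ne_zero _ (by norm_num)) a).symm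

/-! ### Mollification -/

/-- Cauchy–Schwarz against the constant `1`; for a probability measure this is Jensen's inequality.
-/
lemma sq_lintegral_le {α : Type*} [MeasurableSpace α] (μ : Measure α) {g : α → ENNReal}
    (hg : AEMeasurable g μ) : (∫⁻ x, g x ∂μ) ^ 2 ≤ μ univ * ∫⁻ x, g x ^ 2 ∂μ := by
  have h := ENNReal.lintegral_mul_le_Lp_mul_Lq μ Real.HolderConjugate.two_two
    (aemeasurable_const (b := (1 : ENNReal))) hg
  have h2 : (∫⁻ x, g x ∂μ) ≤ (μ univ) ^ (1 / 2 : ℝ) * (∫⁻ x, g x ^ 2 ∂μ) ^ (1 / 2 : ℝ) := by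
    simpa using h
  calc (∫⁻ x, g x ∂μ) ^ 2
      ≤ ((μ univ) ^ (1 / 2 : ℝ) * (∫⁻ x, g x ^ 2 ∂μ) ^ (1 / 2 : ℝ)) ^ 2 := by gcongr
    _ = _ := by
      rw [mul_pow, ← ENNReal.rpow_natCast, ← ENNReal.rpow_natCast, ← ENNReal.rpow_mul,
        ← ENNReal.rpow_mul]
      norm_num

open scoped Convolution in
/-- The mollification of `f` with the normalized bump function `η`. -/
def mollify (η : ContDiffBump (0 : Plane)) (f : Plane → ℝ) : Plane → ℝ :=
  η.normed volume ⋆[ContinuousLinearMap.lsmul ℝ ℝ, volume] f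

section

variable (η : ContDiffBump (0 : Plane))

lemma mollify_apply (f : Plane → ℝ) (x : Plane) :
    mollify η f x = ∫ t, η.normed volume t * f (x - t) := rfl

lemma mollify_apply_swap (f : Plane → ℝ) (x : Plane) :
    mollify η f x = ∫ y, η.normed volume (x - y) * f y := by
  rw [mollify, convolution_eq_swap]; rfl

lemma contDiff_mollify {f : Plane → ℝ} (hf : LocallyIntegrable f) :
    ContDiff ℝ ∞ (mollify η f) :=
  η.hasCompactSupport_normed.contDiff_convolution_left _ η.contDiff_normed hf

lemma fderiv_mollify {f : Plane → ℝ} (hf : LocallyIntegrable f) (x e : Plane) :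
    fderiv ℝ (mollify η f) x e = ∫ y, fderiv ℝ (η.normed volume) (x - y) e * f y := by
  have hη : ContDiff ℝ 1 (η.normed (volume : Measure Plane)) := η.contDiff_normed
  have hc : HasCompactSupport (η.normed (volume : Measure Plane)) := η.hasCompactSupport_normed
  have h := hc.hasFDerivAt_convolution_left
    (ContinuousLinearMap.lsmul ℝ ℝ) hη hf x
  rw [mollify, h.fderiv, convolution_eq_swap]
  have hint : Integrable (fun t => ((ContinuousLinearMap.lsmul ℝ ℝ).precompL Plane
      (fderiv ℝ (η.normed (volume : Measure Plane)) (x - t))) (f t) : Plane → Plane →L[ℝ] ℝ) := by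
    have := (HasCompactSupport.convolutionExists_left
      ((ContinuousLinearMap.lsmul ℝ ℝ : ℝ →L[ℝ] ℝ →L[ℝ] ℝ).precompL Plane)
      (hc.fderiv ℝ) (hη.continuous_fderiv one_ne_zero) hf x)
    exact this.integrable_swap
  rw [ContinuousLinearMap.integral_apply hint]
  rfl

/-- The kernel is a probability density, so Jensen's inequality bounds the square of the average by
the average of the squares; Tonelli and translation invariance finish the proof. -/
lemma sqInt_mollify_le {f : Plane → ℝ} (hf : AEStronglyMeasurable f volume) :
    sqInt univ (mollify η f) ≤ sqInt univ f := by
  set ρ : Plane → ENNReal := fun t => ENNReal.ofReal (η.normed volume t) with hρ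
  have hρm : Measurable ρ := (η.continuous_normed.measurable).ennreal_ofReal
  have hρ1 : ∫⁻ t, ρ t = 1 := by
    rw [hρ, ← ofReal_integral_eq_lintegral_ofReal η.integrable_normed
      (Filter.Eventually.of_forall η.nonneg_normed), η.integral_normed]
    simp
  have hmeas : ∀ x, AEMeasurable (fun t => ‖f (x - t)‖ₑ) := fun x =>
    (hf.enorm.comp_quasiMeasurePreserving (quasiMeasurePreserving_sub_left volume x))
  have hmeas2 : AEMeasurable (fun p : Plane × Plane => ρ p.2 * ‖f (p.1 - p.2)‖ₑ ^ 2)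
      (volume.prod volume) := by
    refine (hρm.comp measurable_snd).aemeasurable.mul (AEMeasurable.pow_const ?_ 2)
    exact hf.enorm.comp_quasiMeasurePreserving (quasiMeasurePreserving_sub volume volume)
  have h1 : ∀ x, ‖mollify η f x‖ₑ ^ 2 ≤ ∫⁻ t, ρ t * ‖f (x - t)‖ₑ ^ 2 := by
    intro x
    have a1 : ‖mollify η f x‖ₑ ≤ ∫⁻ t, ρ t * ‖f (x - t)‖ₑ := by
      rw [mollify_apply]
      refine (enorm_integral_le_lintegral_enorm _).trans (lintegral_mono fun t => ?_)
      rw [enorm_mul, Real.enorm_eq_ofReal (η.nonneg_normed t)]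
    have a2 := sq_lintegral_le (volume.withDensity ρ) (g := fun t => ‖f (x - t)‖ₑ)
      ((hmeas x).mono_ac (withDensity_absolutelyContinuous _ _))
    rw [withDensity_apply _ MeasurableSet.univ, Measure.restrict_univ, hρ1, one_mul,
      lintegral_withDensity_eq_lintegral_mul₀ hρm.aemeasurable (hmeas x),
      lintegral_withDensity_eq_lintegral_mul₀ hρm.aemeasurable ((hmeas x).pow_const 2)] at a2
    exact (pow_le_pow_left₀ zero_le a1 2).trans a2
  simp only [sqInt, Measure.restrict_univ]
  calc ∫⁻ x, ‖mollify η f x‖ₑ ^ 2 ≤ ∫⁻ x, ∫⁻ t, ρ t * ‖f (x - t)‖ₑ ^ 2 := lintegral_mono h1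
    _ = ∫⁻ t, ∫⁻ x, ρ t * ‖f (x - t)‖ₑ ^ 2 := lintegral_lintegral_swap hmeas2
    _ = ∫⁻ t, ρ t * ∫⁻ x, ‖f x‖ₑ ^ 2 := by
      refine lintegral_congr fun t => ?_
      rw [lintegral_const_mul' _ _ (by simp [hρ]),
        lintegral_sub_right_eq_self (fun x => ‖f x‖ₑ ^ 2) t]
    _ = ∫⁻ x, ‖f x‖ₑ ^ 2 := by
      rw [lintegral_mul_const _ hρm, hρ1, one_mul]

/-- The function `y ↦ η (x - y)` is a test function on `U`, because its support lies in the ball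
around `x` and hence in `K`. The sign from differentiating `x - y` cancels the sign of the weak
derivative. Cutting off with `K` makes the functions integrable on the plane and is not felt at such
`x`. -/
lemma partialDeriv_mollify {U K : Set Plane} {l : Fin 2} {v w : Plane → ℝ}
    (h : HasWeakPartial U l v w) (hK : IsCompact K) (hKU : K ⊆ U) {x : Plane}
    (hx : Metric.closedBall x η.rOut ⊆ K) :
    fderiv ℝ (mollify η (K.indicator v)) x (EuclideanSpace.single l 1) =
      mollify η (K.indicator w) x := by
  have hv : LocallyIntegrable (K.indicator v) :=
    ((h.1.integrableOn_compact_subset hKU hK).integrable_indicator hK.measurableSet).locallyIntegrable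
  set ψ : Plane → ℝ := fun y => η.normed volume (x - y) with hψ
  have hs : tsupport ψ ⊆ Metric.closedBall x η.rOut := by
    refine closure_minimal (fun y hy => ?_) Metric.isClosed_closedBall
    have : x - y ∈ Function.support (η.normed (volume : Measure Plane)) := hy
    rw [η.support_normed_eq, mem_ball_zero_iff, ← dist_eq_norm, dist_comm] at this
    exact Metric.mem_closedBall.2 this.le
  have hc : ContDiff ℝ ∞ ψ :=
    (η.contDiff_normed (n := ⊤)).comp (contDiff_const.sub contDiff_id)
  have hd : ∀ y, partialDeriv (fun _ : Fin 1 => l) ψ y =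
      -fderiv ℝ (η.normed volume) (x - y) (EuclideanSpace.single l 1) := by
    intro y
    have h1 : HasFDerivAt (fun y : Plane => x - y) (-ContinuousLinearMap.id ℝ Plane) y :=
      (hasFDerivAt_id y).const_sub x
    have h2 := (((η.contDiff_normed (μ := volume) (n := 1)).differentiable
      one_ne_zero) (x - y)).hasFDerivAt.comp y h1
    rw [partialDeriv_one]
    refine (congrArg (fun L => L (EuclideanSpace.single l 1)) h2.fderiv).trans ?_
    simp
  have key := h.integral_eq hc ((isCompact_closedBall _ _).of_isClosed_subset
    (isClosed_tsupport _) hs) (hs.trans (hx.trans hKU))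
  rw [fderiv_mollify η hv, mollify_apply_swap]
  have e1 : ∀ y, fderiv ℝ (η.normed volume) (x - y) (EuclideanSpace.single l 1) *
      K.indicator v y = -(v y * partialDeriv (fun _ : Fin 1 => l) ψ y) := by
    intro y
    by_cases hy : y ∈ K
    · rw [hd, indicator_of_mem hy]; ring
    · rw [indicator_of_notMem hy, partialDeriv_eq_zero _ fun h => hy (hx (hs h))]; ring
  have e2 : ∀ y, η.normed volume (x - y) * K.indicator w y = w y * ψ y := by
    intro y
    by_cases hy : y ∈ K
    · rw [indicator_of_mem hy, mul_comm]
    · rw [indicator_of_notMem hy, image_eq_zero_of_notMem_tsupport fun h => hy (hx (hs h))]; ring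
  simp only [e1, e2, integral_neg]
  rw [key]
  ring

end

/-- A bump function with outer radius `1 / (n + 1)`. -/
def bumpSeq (n : ℕ) : ContDiffBump (0 : Plane) where
  rIn := 1 / (2 * (n + 1))
  rOut := 1 / (n + 1)
  rIn_pos := by positivity
  rIn_lt_rOut := by
    rw [div_lt_div_iff₀ (by positivity) (by positivity)]
    have : (0 : ℝ) ≤ n := by positivity
    linarith

lemma tendsto_bumpSeq : Filter.Tendsto (fun n => (bumpSeq n).rOut) Filter.atTop (nhds 0) :=
  tendsto_one_div_add_atTop_nhds_zero_nat

lemma ae_tendsto_mollify {f : Plane → ℝ} (hf : LocallyIntegrable f) :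
    ∀ᵐ x, Filter.Tendsto (fun n => mollify (bumpSeq n) f x) Filter.atTop (nhds (f x)) :=
  -- Convergence at almost every point needs a bounded ratio of outer to inner radius; for `bumpSeq`
  -- it is always `2`.
  ContDiffBump.ae_convolution_tendsto_right_of_locallyIntegrable tendsto_bumpSeq (K := 2)
    (Filter.Eventually.of_forall fun n => by
      simp only [bumpSeq]; field_simp; rfl) hf

/-- Fatou's lemma along mollifications that converge almost everywhere. It reduces upper bounds for
Sobolev functions to bounds for smooth ones. -/
lemma sqInt_le_of_mollify_le {f : Plane → ℝ} (hf : LocallyIntegrable f) {A : Set Plane}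
    {B : ENNReal} (h : ∀ᶠ n in Filter.atTop, sqInt A (mollify (bumpSeq n) f) ≤ B) :
    sqInt A f ≤ B := by
  have h1 : sqInt A f ≤ Filter.liminf (fun n => sqInt A (mollify (bumpSeq n) f)) Filter.atTop := by
    calc sqInt A f = ∫⁻ x in A, Filter.liminf (fun n => ‖mollify (bumpSeq n) f x‖ₑ ^ 2)
          Filter.atTop := by
          refine lintegral_congr_ae (ae_restrict_of_ae ?_)
          filter_upwards [ae_tendsto_mollify hf] with x hx
          exact (((ENNReal.continuous_pow 2).tendsto _).comp hx.enorm).liminf_eq.symm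
      _ ≤ _ := lintegral_liminf_le fun n =>
          ((contDiff_mollify _ hf).continuous.measurable.enorm).pow_const 2
  refine h1.trans ?_
  exact (Filter.liminf_le_liminf h).trans (by simp)

/-! ### Trace estimates on boxes -/

/-- The point with coordinate number `i` equal to `p.1`, and the other one equal to `p.2`. -/
def coordMap (i : Fin 2) (p : ℝ × ℝ) : Plane := WithLp.toLp 2 (fun k => if k = i then p.1 else p.2)

@[simp] lemma coordMap_same (i : Fin 2) (p : ℝ × ℝ) : coordMap i p i = p.1 := by
  simp [coordMap]

lemma coordMap_other {i j : Fin 2} (h : i ≠ j) (p : ℝ × ℝ) : coordMap i p j = p.2 := by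
  simp [coordMap, h.symm]

lemma coordMap_self {i j : Fin 2} (h : i ≠ j) (x : Plane) : coordMap i (x i, x j) = x := by
  ext k
  by_cases hk : k = i
  · subst hk; simp
  · have : k = j := by lia
    subst this; simp [coordMap_other h]

lemma ext_of_ne {i j : Fin 2} (h : i ≠ j) {x y : Plane} (hi : x i = y i) (hj : x j = y j) :
    x = y := by
  rw [← coordMap_self h x, ← coordMap_self h y, hi, hj]

lemma measurePreserving_coordMap (i : Fin 2) : MeasurePreserving (coordMap i) := by
  have h0 : MeasurePreserving (fun p : ℝ × ℝ => (WithLp.toLp 2 ![p.1, p.2] : Plane)) :=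
    (EuclideanSpace.volume_preserving_symm_measurableEquiv_toLp (Fin 2)).symm.comp
      (volume_preserving_finTwoArrow ℝ).symm
  rcases (by lia : i = 0 ∨ i = 1) with rfl | rfl
  · convert h0 using 3 with p
    ext k
    fin_cases k <;> simp [coordMap]
  · have h1 := h0.comp (Measure.measurePreserving_swap (μ := (volume : Measure ℝ))
      (ν := (volume : Measure ℝ)))
    rw [← Measure.volume_eq_prod] at h1
    convert h1 using 1
    funext p
    ext k
    fin_cases k <;> simp [coordMap]

lemma measurable_coordMap (i : Fin 2) : Measurable (coordMap i) :=
  (measurePreserving_coordMap i).measurable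

lemma hasDerivAt_coordMap {i j : Fin 2} (h : i ≠ j) (s t : ℝ) :
    HasDerivAt (fun t => coordMap i (s, t)) (EuclideanSpace.single j (1 : ℝ) : Plane) t := by
  have e : (fun t => coordMap i (s, t)) =
      fun t => coordMap i (s, 0) + t • (EuclideanSpace.single j (1 : ℝ) : Plane) := by
    funext t
    refine ext_of_ne h ?_ ?_
    · simp [h]
    · simp [coordMap_other h]
  rw [e]
  simpa using ((hasDerivAt_id t).smul_const (EuclideanSpace.single j (1 : ℝ) : Plane)).const_add
    (coordMap i (s, 0))

lemma lintegral_eq_coordMap (i : Fin 2) {A : Set Plane} (hA : MeasurableSet A)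
    {F : Plane → ENNReal} (hF : Measurable F) :
    ∫⁻ x in A, F x = ∫⁻ s, ∫⁻ t, A.indicator F (coordMap i (s, t)) := by
  rw [← lintegral_indicator hA, ← (measurePreserving_coordMap i).lintegral_comp (hF.indicator hA),
    Measure.volume_eq_prod, lintegral_prod]
  exact ((hF.indicator hA).comp (measurable_coordMap i)).aemeasurable

/-- The closed square with center `z` and side length `2 r`. -/
def box (z : Plane) (r : ℝ) : Set Plane := {x | ∀ k, |x k - z k| ≤ r}

lemma isClosed_box (z : Plane) (r : ℝ) : IsClosed (box z r) := by
  have : box z r = ⋂ k, {x : Plane | |x k - z k| ≤ r} := by ext; simp [box]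
  rw [this]
  exact isClosed_iInter fun k => isClosed_le (by fun_prop) continuous_const

lemma box_subset_closedBall (z : Plane) (r : ℝ) : box z r ⊆ Metric.closedBall z (2 * r) := by
  intro x hx
  have h0 := hx 0
  have h1 := hx 1
  have hr : 0 ≤ r := (abs_nonneg _).trans h0
  rw [Metric.mem_closedBall, EuclideanSpace.dist_eq, Real.sqrt_le_left (by positivity)]
  simp only [Fin.sum_univ_two, Real.dist_eq]
  nlinarith [abs_nonneg (x 0 - z 0), abs_nonneg (x 1 - z 1)]

lemma isCompact_box (z : Plane) (r : ℝ) : IsCompact (box z r) :=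
  (isCompact_closedBall z (2 * r)).of_isClosed_subset (isClosed_box z r)
    (box_subset_closedBall z r)

lemma abs_apply_sub_le_dist (x y : Plane) (k : Fin 2) : |x k - y k| ≤ dist x y := by
  rw [dist_eq_norm]
  exact PiLp.norm_apply_le (x - y) k

lemma closedBall_subset_box (z : Plane) (r : ℝ) : Metric.closedBall z r ⊆ box z r :=
  fun x hx k => (abs_apply_sub_le_dist x z k).trans hx

/-- The embedding of `H¹` in `L^∞` on an interval of length `m = 2r`: write `f t = f s + ∫ f'`,
square, apply Cauchy–Schwarz, and average over `s`. The constant depends on the length only, not on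
the position. -/
lemma exists_sq_enorm_le {r : ℝ} (hr : 0 < r) : ∃ K : NNReal, ∀ (f : ℝ → ℝ) (_ : ContDiff ℝ 1 f)
    (a t : ℝ) (_ : t ∈ Icc (a - r) (a + r)),
    ‖f t‖ₑ ^ 2 ≤ K * ((∫⁻ s in Icc (a - r) (a + r), ‖f s‖ₑ ^ 2) +
      ∫⁻ s in Icc (a - r) (a + r), ‖deriv f s‖ₑ ^ 2) := by
  set m : ENNReal := ENNReal.ofReal (2 * r) with hm
  have hm0 : m ≠ 0 := by simp [hm, hr]
  have hmt : m ≠ ⊤ := ENNReal.ofReal_ne_top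
  have hK : m⁻¹ * (2 * (1 + m ^ 2)) ≠ ⊤ := by
    refine ENNReal.mul_ne_top (by simp [hm0]) (ENNReal.mul_ne_top (by simp) ?_)
    exact ENNReal.add_ne_top.2 ⟨by simp, ENNReal.pow_ne_top hmt⟩
  refine ⟨(m⁻¹ * (2 * (1 + m ^ 2))).toNNReal, fun f hf a t ht => ?_⟩
  rw [ENNReal.coe_toNNReal hK]
  set I := Icc (a - r) (a + r) with hI
  have hvol : volume I = m := by rw [hI, Real.volume_Icc, hm]; congr 1; ring
  have hf' : Continuous (deriv f) := hf.continuous_deriv le_rfl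
  set D := ∫⁻ s in I, ‖deriv f s‖ₑ ^ 2 with hD
  have h1 : ∀ s ∈ I, ‖f t‖ₑ ^ 2 ≤ 2 * (‖f s‖ₑ ^ 2 + m * D) := by
    intro s hs
    have e : f t = f s + ∫ y in s..t, deriv f y := by
      rw [intervalIntegral.integral_deriv_eq_sub
        (fun x _ => (hf.differentiable one_ne_zero) x) (hf'.intervalIntegrable _ _)]
      ring
    have e2 : ‖∫ y in s..t, deriv f y‖ₑ ≤ ∫⁻ y in I, ‖deriv f y‖ₑ := by
      have : ‖∫ y in s..t, deriv f y‖ₑ = ‖∫ y in uIoc s t, deriv f y‖ₑ := by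
        rw [enorm_eq_iff_norm_eq, intervalIntegral.norm_intervalIntegral_eq]
      rw [this]
      refine (enorm_integral_le_lintegral_enorm _).trans (lintegral_mono_set ?_)
      exact uIoc_subset_uIcc.trans (uIcc_subset_Icc hs ht)
    have e3 : (∫⁻ y in I, ‖deriv f y‖ₑ) ^ 2 ≤ m * D := by
      have := sq_lintegral_le (volume.restrict I) (g := fun y => ‖deriv f y‖ₑ)
        hf'.measurable.enorm.aemeasurable
      rwa [Measure.restrict_apply_univ, hvol] at this
    calc ‖f t‖ₑ ^ 2 ≤ (‖f s‖ₑ + ∫⁻ y in I, ‖deriv f y‖ₑ) ^ 2 := by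
          rw [e]
          exact pow_le_pow_left₀ zero_le ((enorm_add_le _ _).trans (by gcongr)) 2
      _ ≤ 2 * (‖f s‖ₑ ^ 2 + (∫⁻ y in I, ‖deriv f y‖ₑ) ^ 2) := by
          have := ENNReal.rpow_add_le_mul_rpow_add_rpow ‖f s‖ₑ (∫⁻ y in I, ‖deriv f y‖ₑ) (p := 2)
            (by norm_num)
          norm_num at this
          exact this
      _ ≤ _ := by gcongr
  have h2 : ‖f t‖ₑ ^ 2 * m ≤ 2 * (1 + m ^ 2) * ((∫⁻ s in I, ‖f s‖ₑ ^ 2) + D) := by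
    calc ‖f t‖ₑ ^ 2 * m = ∫⁻ s in I, ‖f t‖ₑ ^ 2 := by rw [setLIntegral_const, hvol]
      _ ≤ ∫⁻ s in I, 2 * (‖f s‖ₑ ^ 2 + m * D) := setLIntegral_mono' measurableSet_Icc h1
      _ = 2 * ((∫⁻ s in I, ‖f s‖ₑ ^ 2) + m ^ 2 * D) := by
          rw [lintegral_const_mul' _ _ (by simp), lintegral_add_right _ measurable_const,
            setLIntegral_const, hvol]
          ring
      _ ≤ 2 * ((1 + m ^ 2) * (∫⁻ s in I, ‖f s‖ₑ ^ 2) + (1 + m ^ 2) * D) := by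
          gcongr
          · exact le_mul_of_one_le_left zero_le le_self_add
          · exact le_add_self
      _ = _ := by ring
  calc ‖f t‖ₑ ^ 2 = m⁻¹ * (‖f t‖ₑ ^ 2 * m) := by
        rw [mul_comm _ m, ← mul_assoc, ENNReal.inv_mul_cancel hm0 hmt, one_mul]
    _ ≤ m⁻¹ * (2 * (1 + m ^ 2) * ((∫⁻ s in I, ‖f s‖ₑ ^ 2) + D)) := by gcongr
    _ = _ := by ring

/-- Apply the one-dimensional embedding on every line in direction `j`, integrate over the slice of
`A`, which has length at most `δ`, and then over the lines. Only lines with `x i ∈ J` meet `A`, so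
the right-hand side lives on a slab; this slab is what a second application in the other direction
can exploit. -/
lemma exists_sqInt_slab_le {r : ℝ} (hr : 0 < r) {i j : Fin 2} (hij : i ≠ j) :
    ∃ K : NNReal, ∀ (z : Plane) (f : Plane → ℝ) (_ : ContDiff ℝ 1 f) (A : Set Plane)
      (_ : MeasurableSet A) (J : Set ℝ) (_ : MeasurableSet J) (δ : ENNReal) (_ : A ⊆ box z r)
      (_ : ∀ x ∈ A, x i ∈ J) (_ : ∀ s, volume {t | coordMap i (s, t) ∈ A} ≤ δ),
      sqInt A f ≤ K * δ * (sqInt (box z r ∩ {x | x i ∈ J}) f +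
        sqInt (box z r ∩ {x | x i ∈ J}) fun x => fderiv ℝ f x (EuclideanSpace.single j 1)) := by
  obtain ⟨K, hK⟩ := exists_sq_enorm_le hr
  refine ⟨K, fun z f hf A hA J hJ δ hAb hAJ hδ => ?_⟩
  set B := box z r ∩ {x | x i ∈ J} with hB
  have hBm : MeasurableSet B := (isClosed_box z r).measurableSet.inter
    (measurableSet_preimage (by fun_prop) hJ)
  have m1 : Measurable fun x => ‖f x‖ₑ ^ 2 := hf.continuous.measurable.enorm.pow_const 2
  have c2 : Continuous fun x => fderiv ℝ f x (EuclideanSpace.single j 1) :=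
    (hf.continuous_fderiv one_ne_zero).clm_apply continuous_const
  have m2 : Measurable fun x => ‖fderiv ℝ f x (EuclideanSpace.single j 1)‖ₑ ^ 2 :=
    c2.measurable.enorm.pow_const 2
  have hsum : sqInt B f + sqInt B (fun x => fderiv ℝ f x (EuclideanSpace.single j 1)) =
      ∫⁻ x in B, (‖f x‖ₑ ^ 2 + ‖fderiv ℝ f x (EuclideanSpace.single j 1)‖ₑ ^ 2) := by
    rw [lintegral_add_left m1]; rfl
  have m12 : Measurable fun x =>
      ‖f x‖ₑ ^ 2 + ‖fderiv ℝ f x (EuclideanSpace.single j 1)‖ₑ ^ 2 := m1.add m2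
  rw [hsum, lintegral_eq_coordMap i hBm m12, sqInt, lintegral_eq_coordMap i hA m1,
    ← lintegral_const_mul (K * δ) ?_]
  swap
  · exact Measurable.lintegral_prod_right'
      (f := fun p : ℝ × ℝ => B.indicator (fun x => ‖f x‖ₑ ^ 2 +
        ‖fderiv ℝ f x (EuclideanSpace.single j 1)‖ₑ ^ 2) (coordMap i p))
      ((m12.indicator hBm).comp (measurable_coordMap i))
  refine lintegral_mono fun s => ?_
  by_cases hs : {t | coordMap i (s, t) ∈ A}.Nonempty
  swap
  · have : ∀ t, A.indicator (fun x => ‖f x‖ₑ ^ 2) (coordMap i (s, t)) = 0 := by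
      intro t
      exact indicator_of_notMem (fun h : coordMap i (s, t) ∈ A => hs ⟨t, h⟩) _
    simp [this]
  obtain ⟨t₀, ht₀⟩ := hs
  have hsJ : s ∈ J := by simpa using hAJ _ ht₀
  have hsr : |s - z i| ≤ r := by simpa using hAb ht₀ i
  set I := Icc (z j - r) (z j + r) with hI
  have hmem : ∀ t, coordMap i (s, t) ∈ B ↔ t ∈ I := by
    intro t
    rw [hB, hI, mem_Icc]
    simp only [box, mem_inter_iff, mem_ofPred_eq, coordMap_same, hsJ, and_true]
    constructor
    · intro h
      have := h j
      rw [coordMap_other hij, abs_le] at this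
      constructor <;> linarith [this.1, this.2]
    · rintro ⟨h1, h2⟩ k
      by_cases hk : k = i
      · subst hk; simpa using hsr
      · have : k = j := by lia
        subst this
        rw [coordMap_other hij, abs_le]
        constructor <;> simp only <;> linarith
  set φ : ℝ → ℝ := fun t => f (coordMap i (s, t)) with hφ
  have hφd : ∀ t, HasDerivAt φ
      (fderiv ℝ f (coordMap i (s, t)) (EuclideanSpace.single j 1)) t := fun t =>
    ((hf.differentiable one_ne_zero) _).hasFDerivAt.comp_hasDerivAt t (hasDerivAt_coordMap hij s t)
  have hcm : Continuous fun t => coordMap i (s, t) :=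
    continuous_iff_continuousAt.2 fun t => (hasDerivAt_coordMap hij s t).continuousAt
  have hφ1 : ContDiff ℝ 1 φ := by
    rw [contDiff_one_iff_deriv]
    refine ⟨fun t => (hφd t).differentiableAt, ?_⟩
    have : deriv φ = fun t => fderiv ℝ f (coordMap i (s, t)) (EuclideanSpace.single j 1) :=
      funext fun t => (hφd t).deriv
    rw [this]
    exact c2.comp hcm
  have hBint : ∫⁻ t, B.indicator (fun x => ‖f x‖ₑ ^ 2 +
      ‖fderiv ℝ f x (EuclideanSpace.single j 1)‖ₑ ^ 2) (coordMap i (s, t)) =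
      (∫⁻ t in I, ‖φ t‖ₑ ^ 2) + ∫⁻ t in I, ‖deriv φ t‖ₑ ^ 2 := by
    rw [← lintegral_add_left (hφ1.continuous.measurable.enorm.pow_const 2),
      ← lintegral_indicator measurableSet_Icc]
    refine lintegral_congr fun t => ?_
    by_cases ht : t ∈ I
    · rw [indicator_of_mem ((hmem t).2 ht), indicator_of_mem ht, (hφd t).deriv]
    · rw [indicator_of_notMem (fun h => ht ((hmem t).1 h)), indicator_of_notMem ht]
  rw [hBint]
  set E := (∫⁻ t in I, ‖φ t‖ₑ ^ 2) + ∫⁻ t in I, ‖deriv φ t‖ₑ ^ 2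
  have hAs : MeasurableSet {t | coordMap i (s, t) ∈ A} := hA.preimage hcm.measurable
  calc ∫⁻ t, A.indicator (fun x => ‖f x‖ₑ ^ 2) (coordMap i (s, t))
      ≤ ∫⁻ t, {t | coordMap i (s, t) ∈ A}.indicator (fun _ => K * E) t := by
        refine lintegral_mono fun t => ?_
        by_cases ht : coordMap i (s, t) ∈ A
        · rw [indicator_of_mem ht, indicator_of_mem (show t ∈ {t | coordMap i (s, t) ∈ A} from ht)]
          refine hK φ hφ1 (z j) t ((hmem t).1 ⟨hAb ht, hAJ _ ht⟩)
        · rw [indicator_of_notMem ht]; exact zero_le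
    _ = K * E * volume {t | coordMap i (s, t) ∈ A} := by
        rw [lintegral_indicator hAs, setLIntegral_const]
    _ ≤ K * E * δ := by gcongr; exact hδ s
    _ = _ := by ring

lemma eventually_rOut_bumpSeq_le {ε : ℝ} (hε : 0 < ε) :
    ∀ᶠ n in Filter.atTop, (bumpSeq n).rOut ≤ ε :=
  (tendsto_bumpSeq.eventually (gt_mem_nhds hε)).mono fun _ h => h.le

lemma sqInt_mollify_indicator_le {U K B : Set Plane} (hK : IsCompact K) (hKU : K ⊆ U)
    {v : Plane → ℝ} (hv : LocallyIntegrableOn v U) (η : ContDiffBump (0 : Plane)) :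
    sqInt B (mollify η (K.indicator v)) ≤ sqInt U v := by
  have hi : Integrable (K.indicator v) :=
    (hv.integrableOn_compact_subset hKU hK).integrable_indicator hK.measurableSet
  calc sqInt B (mollify η (K.indicator v)) ≤ sqInt univ (mollify η (K.indicator v)) :=
        sqInt_mono (subset_univ _) _
    _ ≤ sqInt univ (K.indicator v) := sqInt_mollify_le η hi.1
    _ = sqInt K v := by
        rw [sqInt, sqInt, Measure.restrict_univ, ← lintegral_indicator hK.measurableSet]
        refine lintegral_congr fun x => ?_
        by_cases hx : x ∈ K <;> simp [hx]
    _ ≤ sqInt U v := sqInt_mono hKU v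

/-- The trace estimate for thin sets in a box, for functions with one weak derivative. -/
theorem exists_sqInt_thin_le {U : Set Plane} (hU : IsOpen U) {z : Plane} {r : ℝ} (hr : 0 < r)
    (hbox : box z r ⊆ U) {i j : Fin 2} (hij : i ≠ j) :
    ∃ K : NNReal, ∀ (v w : Plane → ℝ) (_ : HasWeakPartial U j v w) (A : Set Plane)
      (_ : MeasurableSet A) (δ : ENNReal) (_ : A ⊆ box z r)
      (_ : ∀ s, volume {t | coordMap i (s, t) ∈ A} ≤ δ),
      sqInt A v ≤ K * δ * (sqInt U v + sqInt U w) := by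
  obtain ⟨K, hK⟩ := exists_sqInt_slab_le hr hij
  -- A compact neighbourhood of the box inside `U`: mollification with radius at most `ε` at points
  -- of the box sees only values from there.
  obtain ⟨ε, hε, hεU⟩ := (isCompact_box z r).exists_cthickening_subset_open hU hbox
  refine ⟨K, fun v w hvw A hA δ hAb hδ => ?_⟩
  set C := Metric.cthickening ε (box z r)
  have hC : IsCompact C := (isCompact_box z r).cthickening
  have hv : LocallyIntegrable (C.indicator v) :=
    ((hvw.1.integrableOn_compact_subset hεU hC).integrable_indicator hC.measurableSet).locallyIntegrable
  have e : sqInt A v = sqInt A (C.indicator v) :=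
    sqInt_congr ((ae_restrict_iff' hA).2 (Filter.Eventually.of_forall fun x hx =>
      (indicator_of_mem (Metric.self_subset_cthickening _ (hAb hx)) v).symm))
  rw [e]
  refine sqInt_le_of_mollify_le hv ?_
  filter_upwards [eventually_rOut_bumpSeq_le hε] with n hn
  refine (hK z _ ((contDiff_mollify _ hv).of_le (by simp)) A hA univ .univ δ hAb
    (fun _ _ => mem_univ _) hδ).trans ?_
  have e2 : sqInt (box z r ∩ {x | x i ∈ univ}) (fun x => fderiv ℝ (mollify (bumpSeq n)
      (C.indicator v)) x (EuclideanSpace.single j 1)) =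
      sqInt (box z r ∩ {x | x i ∈ univ}) (mollify (bumpSeq n) (C.indicator w)) := by
    simp only [mem_univ, ofPred_true, inter_univ]
    refine sqInt_congr ((ae_restrict_iff' (isClosed_box z r).measurableSet).2
      (Filter.Eventually.of_forall fun x hx => partialDeriv_mollify _ hvw hC hεU ?_))
    exact (Metric.closedBall_subset_closedBall hn).trans
      (Metric.closedBall_subset_cthickening hx ε)
  rw [e2]
  gcongr
  · exact sqInt_mollify_indicator_le hC hεU hvw.1 _
  · exact sqInt_mollify_indicator_le hC hεU hvw.2.1 _

/-- The trace estimate for sets in a box that are thin in both directions. -/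
theorem exists_sqInt_small_le {U : Set Plane} (hU : IsOpen U) {z : Plane} {r : ℝ} (hr : 0 < r)
    (hbox : box z r ⊆ U) {i j : Fin 2} (hij : i ≠ j) :
    ∃ K : NNReal, ∀ (v vi vj vij : Plane → ℝ) (_ : HasWeakPartial U i v vi)
      (_ : HasWeakPartial U j v vj) (_ : HasWeakPartial U i vj vij) (A : Set Plane)
      (_ : MeasurableSet A) (J : Set ℝ) (_ : MeasurableSet J) (δ : ENNReal) (_ : A ⊆ box z r)
      (_ : ∀ x ∈ A, x i ∈ J) (_ : ∀ s, volume {t | coordMap i (s, t) ∈ A} ≤ δ),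
      sqInt A v ≤ K * (δ * volume J) *
        (sqInt U v + sqInt U vi + (sqInt U vj + sqInt U vij)) := by
  obtain ⟨K, hK⟩ := exists_sqInt_slab_le hr hij
  obtain ⟨K', hK'⟩ := exists_sqInt_slab_le hr hij.symm
  obtain ⟨ε, hε, hεU⟩ := (isCompact_box z r).exists_cthickening_subset_open hU hbox
  refine ⟨K * K', fun v vi vj vij hvi hvj hvij A hA J hJ δ hAb hAJ hδ => ?_⟩
  set C := Metric.cthickening ε (box z r)
  have hC : IsCompact C := (isCompact_box z r).cthickening
  have hind : ∀ {f : Plane → ℝ}, LocallyIntegrableOn f U → LocallyIntegrable (C.indicator f) :=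
    fun hf => ((hf.integrableOn_compact_subset hεU hC).integrable_indicator
      hC.measurableSet).locallyIntegrable
  have e : sqInt A v = sqInt A (C.indicator v) :=
    sqInt_congr ((ae_restrict_iff' hA).2 (Filter.Eventually.of_forall fun x hx =>
      (indicator_of_mem (Metric.self_subset_cthickening _ (hAb hx)) v).symm))
  rw [e]
  refine sqInt_le_of_mollify_le (hind hvi.1) ?_
  filter_upwards [eventually_rOut_bumpSeq_le hε] with n hn
  have hD : ∀ {B : Set Plane} (_ : MeasurableSet B) (_ : B ⊆ box z r) {l : Fin 2}
      {f g : Plane → ℝ} (_ : HasWeakPartial U l f g),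
      sqInt B (fun x => fderiv ℝ (mollify (bumpSeq n) (C.indicator f)) x
        (EuclideanSpace.single l 1)) = sqInt B (mollify (bumpSeq n) (C.indicator g)) := by
    intro B hB hBb l f g hfg
    refine sqInt_congr ((ae_restrict_iff' hB).2
      (Filter.Eventually.of_forall fun x hx => partialDeriv_mollify _ hfg hC hεU ?_))
    exact (Metric.closedBall_subset_closedBall hn).trans
      (Metric.closedBall_subset_cthickening (hBb hx) ε)
  have hbm := (isClosed_box z r).measurableSet
  set B := box z r ∩ {x | x i ∈ J} with hB
  have hBm : MeasurableSet B := hbm.inter (measurableSet_preimage (by fun_prop) hJ)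
  -- Seen in direction `i`, the slab `B` is itself thin: its slices lie in `J`. So the slab estimate
  -- applies to `B` with the two coordinates exchanged.
  have hslice : ∀ s, volume {t | coordMap j (s, t) ∈ B} ≤ volume J := by
    refine fun s => measure_mono fun t ht => ?_
    have := ht.2
    rwa [mem_ofPred_eq, coordMap_other hij.symm] at this
  have hB2 : ∀ {f g : Plane → ℝ} (_ : HasWeakPartial U i f g),
      sqInt B (mollify (bumpSeq n) (C.indicator f)) ≤
        K' * volume J * (sqInt U f + sqInt U g) := by
    intro f g hfg
    refine (hK' z _ ((contDiff_mollify _ (hind hfg.1)).of_le (by simp)) B hBm univ .univ _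
      inter_subset_left (fun _ _ => mem_univ _) hslice).trans ?_
    simp only [mem_univ, ofPred_true, inter_univ]
    rw [hD hbm subset_rfl hfg]
    gcongr
    · exact sqInt_mollify_indicator_le hC hεU hfg.1 _
    · exact sqInt_mollify_indicator_le hC hεU hfg.2.1 _
  -- First direction `j` on `A`, which brings in `vj`; then direction `i` on `B` for both `v` and
  -- `vj`, which brings in `vi` and the mixed derivative `vij`.
  calc sqInt A (mollify (bumpSeq n) (C.indicator v))
      ≤ K * δ * (sqInt B (mollify (bumpSeq n) (C.indicator v)) +
          sqInt B (mollify (bumpSeq n) (C.indicator vj))) := by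
        rw [← hD hBm inter_subset_left hvj]
        exact hK z _ ((contDiff_mollify _ (hind hvi.1)).of_le (by simp)) A hA J hJ δ hAb hAJ hδ
    _ ≤ K * δ * (K' * volume J * (sqInt U v + sqInt U vi) +
          K' * volume J * (sqInt U vj + sqInt U vij)) := by
        gcongr
        exacts [hB2 hvi, hB2 hvij]
    _ = _ := by push_cast; ring

/-! ### Charts of the interface -/

/-- In the square with center `z` and side length `2 r`, which lies in `Ω`, the set `Γ` is
contained in the graph of a function `g` of class `C³` of the coordinate number `i`. -/
structure IsGraphChart (Ω Γ : Set Plane) (z : Plane) (r : ℝ) (i j : Fin 2) (g : ℝ → ℝ) : Prop where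
  ne : i ≠ j
  pos : 0 < r
  box_subset : box z r ⊆ Ω
  contDiff : ContDiff ℝ 3 g
  eq : ∀ x ∈ Γ, x ∈ box z r → x j = g (x i)
  osc : ∀ s ∈ Icc (z i - r) (z i + r), ∀ t ∈ Icc (z i - r) (z i + r), |deriv g s - deriv g t| ≤ 1

lemma periodic_curve {m : ℕ} {γ : Fin m → ℝ → Plane} (hp : ∀ i t, γ i (t + 1) = γ i t)
    (k : Fin m) (a : ℝ) : range (γ k) = γ k '' Icc a (a + 1) :=
  (Function.Periodic.image_Icc (f := γ k) (fun t => hp k t) one_pos a).symm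

lemma HasC3Parametrization.isCompact {Γ : Set Plane} (h : HasC3Parametrization Γ) :
    IsCompact Γ := by
  obtain ⟨m, γ, h1, h2, h3, h4, rfl⟩ := h
  refine isCompact_iUnion fun k => ?_
  rw [periodic_curve h3 k 0]
  exact isCompact_Icc.image (h1 k).continuous

/-- Near a point `γ k t₀` the curves only consist of points with parameters near `t₀`. -/
lemma eventually_mem_image_Ioo {m : ℕ} {γ : Fin m → ℝ → Plane} (hc : ∀ i, Continuous (γ i))
    (hp : ∀ i t, γ i (t + 1) = γ i t)
    (hinj : ∀ i j s t, γ i s = γ j t → i = j ∧ ∃ n : ℤ, t = s + n) (k : Fin m) (t₀ : ℝ) {η : ℝ}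
    (hη : 0 < η) (hη' : η < 1 / 2) :
    ∀ᶠ x in nhds (γ k t₀), x ∈ (⋃ i, range (γ i)) → x ∈ γ k '' Ioo (t₀ - η) (t₀ + η) := by
  -- All of the curves except the short arc around `t₀`. It is closed, and by injectivity modulo the
  -- period it does not contain `γ k t₀`: otherwise there would be an integer strictly between `0`
  -- and `1`.
  set Γ' : Set Plane := (⋃ l ∈ {l : Fin m | l ≠ k}, range (γ l)) ∪
    γ k '' Icc (t₀ + η) (t₀ + 1 - η) with hΓ'
  have hcl : IsClosed Γ' := by
    refine IsClosed.union (Set.Finite.isClosed_biUnion (Set.toFinite _) fun l _ => ?_) ?_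
    · rw [periodic_curve hp l 0]
      exact (isCompact_Icc.image (hc l)).isClosed
    · exact (isCompact_Icc.image (hc k)).isClosed
  have hz : γ k t₀ ∉ Γ' := by
    rintro (h | ⟨t, ht, h⟩)
    · simp only [mem_iUnion] at h
      obtain ⟨l, hl, t, ht⟩ := h
      exact hl (hinj _ _ _ _ ht).1
    · obtain ⟨-, n, hn⟩ := hinj _ _ _ _ h
      have a1 : (0 : ℝ) < -n := by linarith [ht.1]
      have a2 : (-n : ℝ) < 1 := by linarith [ht.2]
      have b1 : 0 < -n := by exact_mod_cast a1
      have b2 : -n < 1 := by exact_mod_cast a2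
      lia
  filter_upwards [hcl.isOpen_compl.mem_nhds hz] with x hx hxΓ
  obtain ⟨l, hl⟩ := mem_iUnion.1 hxΓ
  have hlk : l = k := by
    by_contra hne
    exact hx (Or.inl (mem_biUnion (show l ∈ {l | l ≠ k} from hne) hl))
  subst hlk
  rw [periodic_curve hp l (t₀ - η)] at hl
  obtain ⟨t, ht, rfl⟩ := hl
  by_cases h1 : t < t₀ + η
  · rcases ht.1.eq_or_lt with h | h
    · exfalso
      refine hx (Or.inr ⟨t + 1, ⟨by linarith, by linarith⟩, hp l t⟩)
    · exact ⟨t, ⟨h, h1⟩, rfl⟩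
  · exfalso
    exact hx (Or.inr ⟨t, ⟨not_lt.1 h1, by linarith [ht.2]⟩, rfl⟩)

/-- The inverse function theorem provides the graph only locally, whereas `IsGraphChart` asks for a
function that is `C³` on the whole line; multiplication by a bump function bridges the gap. -/
lemma exists_contDiff_eventuallyEq {g : ℝ → ℝ} {a : ℝ} (hg : ContDiffAt ℝ 3 g a) :
    ∃ G : ℝ → ℝ, ContDiff ℝ 3 G ∧ G =ᶠ[nhds a] g := by
  have h1 := hg.eventually (by norm_num)
  obtain ⟨ε, hε, hball⟩ := Metric.eventually_nhds_iff_ball.1 h1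
  let χ : ContDiffBump a := ⟨ε / 4, ε / 2, by positivity, by linarith⟩
  refine ⟨fun x => χ x * g x, ?_, ?_⟩
  · rw [contDiff_iff_contDiffAt]
    intro x
    by_cases hx : x ∈ Metric.ball a ε
    · exact χ.contDiff.contDiffAt.mul (hball x hx)
    · refine (contDiffAt_const (c := (0 : ℝ))).congr_of_eventuallyEq ?_
      have : x ∈ (Metric.closedBall a (ε / 2))ᶜ := by
        simp only [Metric.mem_ball, not_lt] at hx
        simp only [mem_compl_iff, Metric.mem_closedBall, not_le]
        linarith
      filter_upwards [Metric.isClosed_closedBall.isOpen_compl.mem_nhds this] with y hy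
      rw [χ.zero_of_le_dist, zero_mul]
      simp only [mem_compl_iff, Metric.mem_closedBall, not_le] at hy
      exact hy.le
  · filter_upwards [Metric.closedBall_mem_nhds a (show 0 < ε / 4 by positivity)] with x hx
    rw [χ.one_of_mem_closedBall hx, one_mul]

/-- Some coordinate `i` of the tangent vector is nonzero, so `t ↦ γ k t i` has a local `C³` inverse
`τ`, and near the point `Γ` is the graph of the other coordinate composed with `τ`. Other curves,
and remote parts of the same curve, stay away by `eventually_mem_image_Ioo`. -/
theorem exists_isGraphChart {Ω Γ : Set Plane} (hΩ : IsOpen Ω) (hΓΩ : Γ ⊆ Ω)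
    (h : HasC3Parametrization Γ) {z : Plane} (hz : z ∈ Γ) :
    ∃ r i j g, IsGraphChart Ω Γ z r i j g := by
  obtain ⟨m, γ, hd, hreg, hp, hinj, rfl⟩ := h
  obtain ⟨k, t₀, rfl⟩ := mem_iUnion.1 hz
  obtain ⟨i, hi⟩ : ∃ i, deriv (γ k) t₀ i ≠ 0 := by
    by_contra! hcon
    exact hreg k t₀ (by ext i; simpa using hcon i)
  obtain ⟨j, hij⟩ : ∃ j, i ≠ j := ⟨1 - i, by lia⟩
  have hcoord : ∀ l : Fin 2, ContDiff ℝ 3 (fun t => γ k t l) := fun l =>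
    (EuclideanSpace.proj l : Plane →L[ℝ] ℝ).contDiff.comp (hd k)
  have hderiv : HasDerivAt (fun t => γ k t i) (deriv (γ k) t₀ i) t₀ :=
    (EuclideanSpace.proj i : Plane →L[ℝ] ℝ).hasFDerivAt.comp_hasDerivAt t₀
      (((hd k).differentiable (by norm_num)) t₀).hasDerivAt
  have hequiv := hderiv.hasFDerivAt_equiv hi
  have hcd : ContDiffAt ℝ 3 (fun t => γ k t i) t₀ := (hcoord i).contDiffAt
  set τ := hcd.localInverse hequiv (by norm_num) with hτ
  have hτd : ContDiffAt ℝ 3 τ (γ k t₀ i) := hcd.to_localInverse hequiv (by norm_num)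
  have hτl : ∀ᶠ t in nhds t₀, τ (γ k t i) = t :=
    (hcd.hasStrictFDerivAt' hequiv (by norm_num)).eventually_left_inverse
  obtain ⟨g, hg, hge⟩ := exists_contDiff_eventuallyEq
    ((hcoord j).contDiffAt.comp (γ k t₀ i) hτd)
  obtain ⟨η₀, hη₀, hη⟩ := Metric.eventually_nhds_iff_ball.1 hτl
  have hη1 : 0 < min η₀ (1 / 4) := by positivity
  have hloc := eventually_mem_image_Ioo (fun i => (hd i).continuous) hp hinj k t₀ hη1
    (by linarith [min_le_right η₀ (1 / 4)])
  have hgc : Continuous (deriv g) := hg.continuous_deriv (by norm_num)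
  -- Deviation below `1 / 2` from the value at the center gives oscillation at most `1`.
  have hosc : ∀ᶠ s in nhds (γ k t₀ i), |deriv g s - deriv g (γ k t₀ i)| < 1 / 2 := by
    have := (hgc.tendsto (γ k t₀ i)).eventually (Metric.ball_mem_nhds _ (show (0 : ℝ) < 1 / 2 by norm_num))
    exact this
  have hproj : Filter.Tendsto (fun x : Plane => x i) (nhds (γ k t₀)) (nhds (γ k t₀ i)) :=
    Continuous.tendsto (by fun_prop) _
  obtain ⟨ε₁, hε₁, h₁⟩ := Metric.eventually_nhds_iff_ball.1
    (hloc.and ((hproj.eventually hge).and (hΩ.mem_nhds (hΓΩ hz))))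
  obtain ⟨ε₂, hε₂, h₂⟩ := Metric.eventually_nhds_iff_ball.1 hosc
  set r := min (ε₁ / 4) (ε₂ / 2) with hr
  have hr0 : 0 < r := by positivity
  have hb : ∀ x ∈ box (γ k t₀) r, x ∈ Metric.ball (γ k t₀) ε₁ := by
    intro x hx
    have a1 := box_subset_closedBall _ _ hx
    rw [Metric.mem_closedBall] at a1
    rw [Metric.mem_ball]
    linarith [min_le_left (ε₁ / 4) (ε₂ / 2)]
  have hosc2 : ∀ s ∈ Icc (γ k t₀ i - r) (γ k t₀ i + r),
      |deriv g s - deriv g (γ k t₀ i)| < 1 / 2 := by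
    intro s hs
    refine h₂ s ?_
    rw [Metric.mem_ball, Real.dist_eq, abs_lt]
    constructor <;> linarith [hs.1, hs.2, min_le_right (ε₁ / 4) (ε₂ / 2)]
  refine ⟨r, i, j, g, hij, hr0, fun x hx => (h₁ x (hb x hx)).2.2, hg, ?_, ?_⟩
  · intro x hxΓ hx
    obtain ⟨a1, a2, -⟩ := h₁ x (hb x hx)
    obtain ⟨t, ht, rfl⟩ := a1 hxΓ
    have : τ (γ k t i) = t := by
      refine hη t ?_
      rw [Metric.mem_ball, Real.dist_eq, abs_lt]
      constructor <;> linarith [ht.1, ht.2, min_le_left η₀ (1 / 4)]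
    rw [a2]
    simp [this]
  · intro s hs t ht
    have := abs_lt.1 (hosc2 s hs)
    have := abs_lt.1 (hosc2 t ht)
    rw [abs_le]
    constructor <;> linarith

/-! ### Interpolation errors -/

lemma abs_le_of_hasDerivAt {f f' : ℝ → ℝ} {M c : ℝ} (h : ∀ t, HasDerivAt f (f' t) t)
    (hM : ∀ t ∈ Icc (0 : ℝ) 1, |f' t| ≤ M) (hc : c ∈ Icc (0 : ℝ) 1) (h0 : f c = 0) :
    ∀ t ∈ Icc (0 : ℝ) 1, |f t| ≤ M := by
  intro t ht
  have := (convex_Icc (0 : ℝ) 1).norm_image_sub_le_of_norm_hasDerivWithin_le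
    (fun x _ => (h x).hasDerivWithinAt) hM hc ht
  rw [h0, sub_zero, Real.norm_eq_abs, Real.norm_eq_abs] at this
  have hM0 : 0 ≤ M := (abs_nonneg _).trans (hM t ht)
  have : |t - c| ≤ 1 := by
    rw [abs_le]; constructor <;> linarith [ht.1, ht.2, hc.1, hc.2]
  nlinarith

lemma abs_le_of_two_zeros {f f₁ f₂ : ℝ → ℝ} {M : ℝ} (h : ∀ t, HasDerivAt f (f₁ t) t)
    (h₁ : ∀ t, HasDerivAt f₁ (f₂ t) t) (hM : ∀ t ∈ Icc (0 : ℝ) 1, |f₂ t| ≤ M)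
    (h0 : f 0 = 0) (h1 : f 1 = 0) : ∀ t ∈ Icc (0 : ℝ) 1, |f t| ≤ M := by
  have hcont : Continuous f := continuous_iff_continuousAt.2 fun t => (h t).continuousAt
  obtain ⟨c, hc, hc0⟩ := exists_hasDerivAt_eq_zero zero_lt_one hcont.continuousOn
    (h0.trans h1.symm) (fun t _ => h t)
  exact abs_le_of_hasDerivAt h (abs_le_of_hasDerivAt h₁ hM (Ioo_subset_Icc_self hc) hc0)
    (by simp) h0

/-- By Rolle `f₁` has two zeros and `f₂` has one; integrating the bound on `f₃` from these zeros
three times costs no factor, as the interval has length `1`. -/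
lemma abs_le_of_three_zeros {f f₁ f₂ f₃ : ℝ → ℝ} {M : ℝ} (h : ∀ t, HasDerivAt f (f₁ t) t)
    (h₁ : ∀ t, HasDerivAt f₁ (f₂ t) t) (h₂ : ∀ t, HasDerivAt f₂ (f₃ t) t)
    (hM : ∀ t ∈ Icc (0 : ℝ) 1, |f₃ t| ≤ M)
    (h0 : f 0 = 0) (hh : f (1 / 2) = 0) (h1 : f 1 = 0) : ∀ t ∈ Icc (0 : ℝ) 1, |f t| ≤ M := by
  have hcont : Continuous f := continuous_iff_continuousAt.2 fun t => (h t).continuousAt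
  have hcont1 : Continuous f₁ := continuous_iff_continuousAt.2 fun t => (h₁ t).continuousAt
  obtain ⟨c, hc, hc0⟩ := exists_hasDerivAt_eq_zero (show (0 : ℝ) < 1 / 2 by norm_num)
    hcont.continuousOn (h0.trans hh.symm) (fun t _ => h t)
  obtain ⟨d, hd, hd0⟩ := exists_hasDerivAt_eq_zero (show (1 / 2 : ℝ) < 1 by norm_num)
    hcont.continuousOn (hh.trans h1.symm) (fun t _ => h t)
  obtain ⟨e, he, he0⟩ := exists_hasDerivAt_eq_zero (hc.2.trans hd.1)
    hcont1.continuousOn (hc0.trans hd0.symm) (fun t _ => h₁ t)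
  have a2 := abs_le_of_hasDerivAt h₂ hM
    (c := e) ⟨by linarith [hc.1, he.1], by linarith [hd.2, he.2]⟩ he0
  have a1 := abs_le_of_hasDerivAt h₁ a2 (c := c) ⟨hc.1.le, by linarith [hc.2]⟩ hc0
  exact abs_le_of_hasDerivAt h a1 (by simp) h0

lemma exists_deriv_bounds {g : ℝ → ℝ} (hg : ContDiff ℝ 3 g) (α β : ℝ) :
    ∃ (M : ℝ) (g₁ g₂ g₃ : ℝ → ℝ), 0 ≤ M ∧ g₁ = deriv g ∧ (∀ x, HasDerivAt g (g₁ x) x) ∧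
      (∀ x, HasDerivAt g₁ (g₂ x) x) ∧ (∀ x, HasDerivAt g₂ (g₃ x) x) ∧
      ∀ x ∈ Icc α β, |g₁ x| ≤ M ∧ |g₂ x| ≤ M ∧ |g₃ x| ≤ M := by
  have c1 : ContDiff ℝ 2 (deriv g) := by
    have : ContDiff ℝ (2 + 1) g := by convert hg using 1; norm_num
    exact (contDiff_succ_iff_deriv.1 this).2.2
  have c2 : ContDiff ℝ 1 (deriv (deriv g)) := by
    have : ContDiff ℝ (1 + 1) (deriv g) := by convert c1 using 1; norm_num
    exact (contDiff_succ_iff_deriv.1 this).2.2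
  have c3 : Continuous (deriv (deriv (deriv g))) := c2.continuous_deriv le_rfl
  obtain ⟨M₁, hM₁⟩ := isCompact_Icc.exists_bound_of_continuousOn (s := Icc α β)
    c1.continuous.continuousOn
  obtain ⟨M₂, hM₂⟩ := isCompact_Icc.exists_bound_of_continuousOn (s := Icc α β)
    c2.continuous.continuousOn
  obtain ⟨M₃, hM₃⟩ := isCompact_Icc.exists_bound_of_continuousOn (s := Icc α β)
    c3.continuousOn
  refine ⟨|M₁| + |M₂| + |M₃|, deriv g, deriv (deriv g), deriv (deriv (deriv g)), by positivity,
    rfl, fun x => ((hg.differentiable (by norm_num)) x).hasDerivAt,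
    fun x => ((c1.differentiable (by norm_num)) x).hasDerivAt,
    fun x => ((c2.differentiable (by norm_num)) x).hasDerivAt, fun x hx => ?_⟩
  have h1 := hM₁ x hx
  have h2 := hM₂ x hx
  have h3 := hM₃ x hx
  rw [Real.norm_eq_abs] at h1 h2 h3
  have := le_abs_self M₁
  have := le_abs_self M₂
  have := le_abs_self M₃
  have := abs_nonneg M₁
  have := abs_nonneg M₂
  have := abs_nonneg M₃
  refine ⟨?_, ?_, ?_⟩ <;> linarith

/-- The error of linear interpolation. -/
lemma abs_segment_sub_le {g g₁ g₂ : ℝ → ℝ} {α β M : ℝ} (h : ∀ x, HasDerivAt g (g₁ x) x)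
    (h₁ : ∀ x, HasDerivAt g₁ (g₂ x) x) (hM : ∀ x ∈ Icc α β, |g₂ x| ≤ M) {x₀ x₁ : ℝ}
    (hx₀ : x₀ ∈ Icc α β) (hx₁ : x₁ ∈ Icc α β) {t : ℝ} (ht : t ∈ Icc (0 : ℝ) 1) :
    |(1 - t) * g x₀ + t * g x₁ - g ((1 - t) * x₀ + t * x₁)| ≤ M * (x₁ - x₀) ^ 2 := by
  have hX : ∀ t, HasDerivAt (fun t : ℝ => (1 - t) * x₀ + t * x₁) (x₁ - x₀) t := fun t => by
    refine ((((hasDerivAt_id t).const_sub 1).mul_const x₀).add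
      ((hasDerivAt_id t).mul_const x₁)).congr_deriv ?_
    ring
  have hY : ∀ t, HasDerivAt (fun t : ℝ => (1 - t) * g x₀ + t * g x₁) (g x₁ - g x₀) t :=
    fun t => by
    refine ((((hasDerivAt_id t).const_sub 1).mul_const (g x₀)).add
      ((hasDerivAt_id t).mul_const (g x₁))).congr_deriv ?_
    ring
  refine abs_le_of_two_zeros
    (f := fun t => (1 - t) * g x₀ + t * g x₁ - g ((1 - t) * x₀ + t * x₁))
    (f₁ := fun t => (g x₁ - g x₀) - g₁ ((1 - t) * x₀ + t * x₁) * (x₁ - x₀))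
    (f₂ := fun t => -(g₂ ((1 - t) * x₀ + t * x₁) * (x₁ - x₀) * (x₁ - x₀)))
    (fun t => (hY t).sub ((h _).comp t (hX t)))
    (fun t => (((h₁ _).comp t (hX t)).mul_const _).const_sub _) ?_ (by simp) (by simp) t ht
  intro t ht
  have hmem : (1 - t) * x₀ + t * x₁ ∈ Icc α β :=
    (convex_Icc α β) hx₀ hx₁ (by linarith [ht.2]) ht.1 (by ring)
  rw [abs_neg, mul_assoc, abs_mul, ← sq, abs_of_nonneg (sq_nonneg (x₁ - x₀))]
  gcongr
  exact hM _ hmem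

/-- The mean value theorem in a form that needs no order of the points and allows them to coincide,
as a midnode may coincide with the middle of its chord. -/
lemma exists_slope_eq {g g₁ : ℝ → ℝ} {α β : ℝ} (h : ∀ x, HasDerivAt g (g₁ x) x) {a b : ℝ}
    (ha : a ∈ Icc α β) (hb : b ∈ Icc α β) : ∃ ξ ∈ Icc α β, g b - g a = g₁ ξ * (b - a) := by
  have hc : Continuous g := continuous_iff_continuousAt.2 fun x => (h x).continuousAt
  rcases lt_trichotomy a b with hab | hab | hab
  · obtain ⟨ξ, hξ, e⟩ := exists_hasDerivAt_eq_slope g g₁ hab hc.continuousOn (fun x _ => h x)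
    refine ⟨ξ, ⟨ha.1.trans hξ.1.le, hξ.2.le.trans hb.2⟩, ?_⟩
    rw [e, div_mul_cancel₀ _ (sub_ne_zero.2 hab.ne')]
  · exact ⟨a, ha, by simp [hab]⟩
  · obtain ⟨ξ, hξ, e⟩ := exists_hasDerivAt_eq_slope g g₁ hab hc.continuousOn (fun x _ => h x)
    refine ⟨ξ, ⟨hb.1.trans hξ.1.le, hξ.2.le.trans ha.2⟩, ?_⟩
    have : g a - g b = g₁ ξ * (a - b) := by
      rw [e, div_mul_cancel₀ _ (sub_ne_zero.2 hab.ne')]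
    linarith

/-- If the midnode lies on the perpendicular bisector of a chord of a graph, then it is close to
the midpoint of the chord. -/
lemma abs_second_difference_le {g g₁ g₂ : ℝ → ℝ} {α β M h : ℝ}
    (hd : ∀ x, HasDerivAt g (g₁ x) x) (hd₁ : ∀ x, HasDerivAt g₁ (g₂ x) x)
    (hM₁ : ∀ x ∈ Icc α β, |g₁ x| ≤ M) (hM₂ : ∀ x ∈ Icc α β, |g₂ x| ≤ M)
    (hosc : ∀ s ∈ Icc α β, ∀ t ∈ Icc α β, |g₁ s - g₁ t| ≤ 1)
    {x₀ m x₁ : ℝ} (hx₀ : x₀ ∈ Icc α β) (hm : m ∈ Icc α β) (hx₁ : x₁ ∈ Icc α β)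
    (hne : x₀ ≠ x₁) (hh : |x₁ - x₀| ≤ h)
    (hdist : (m - x₀) ^ 2 + (g m - g x₀) ^ 2 = (m - x₁) ^ 2 + (g m - g x₁) ^ 2) :
    |x₀ - 2 * m + x₁| ≤ 3 * M ^ 2 * h ^ 2 := by
  have hM : 0 ≤ M := (abs_nonneg _).trans (hM₁ _ hx₀)
  set c := (x₀ + x₁) / 2 with hc
  have hcm : c ∈ Icc α β := ⟨by linarith [hx₀.1, hx₁.1], by linarith [hx₀.2, hx₁.2]⟩
  obtain ⟨ξ, hξ, e1⟩ := exists_slope_eq hd hx₀ hx₁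
  obtain ⟨ζ, hζ, e2⟩ := exists_slope_eq hd hm hcm
  have e3 := abs_segment_sub_le hd hd₁ hM₂ hx₀ hx₁ (t := 1 / 2) ⟨by norm_num, by norm_num⟩
  have e4 : (1 - 1 / 2) * x₀ + 1 / 2 * x₁ = c := by rw [hc]; ring
  rw [e4] at e3
  set e := g x₀ + g x₁ - 2 * g c with he
  have e5 : |e| ≤ 2 * M * h ^ 2 := by
    have h1 : (x₁ - x₀) ^ 2 ≤ h ^ 2 := sq_le_sq' (by linarith [(abs_le.1 hh).1]) (abs_le.1 hh).2
    have h2 : e = 2 * ((1 - 1 / 2) * g x₀ + 1 / 2 * g x₁ - g c) := by rw [he]; ring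
    rw [h2, abs_mul, abs_two]
    nlinarith
  set D := x₀ - 2 * m + x₁ with hD
  -- Here `D = 2 (c - m)`: the second difference at `m` is the one at the midpoint `c`, plus the
  -- slope between `m` and `c` times `D`.
  have e6 : g x₀ - 2 * g m + g x₁ = e + g₁ ζ * D := by
    have : g₁ ζ * D = 2 * (g₁ ζ * (c - m)) := by rw [hD, hc]; ring
    rw [this, ← e2, he]; ring
  -- Equal distances mean that the vector from the midnode to the middle of the chord is orthogonal
  -- to the chord; the factor `x₁ - x₀` is taken out of both components.
  have e7 : (x₁ - x₀) * (D + g₁ ξ * (e + g₁ ζ * D)) = 0 := by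
    rw [← e6]
    have : g₁ ξ * (x₁ - x₀) = g x₁ - g x₀ := e1.symm
    have h2 : (x₁ - x₀) * (D + g₁ ξ * (g x₀ - 2 * g m + g x₁)) =
      (x₁ - x₀) * D + (g₁ ξ * (x₁ - x₀)) * (g x₀ - 2 * g m + g x₁) := by ring
    rw [h2, this, hD]
    linarith
  have e8 : D * (1 + g₁ ξ * g₁ ζ) = -(g₁ ξ * e) := by
    have := (mul_eq_zero.1 e7).resolve_left (sub_ne_zero.2 hne.symm)
    linarith
  -- From `4ab = (a + b)² - (a - b)²` and `|a - b| ≤ 1` one gets `ab ≥ -1/4`. This is the purpose of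
  -- the oscillation bound: the coefficient of `D` stays away from zero.
  have e9 : 3 / 4 ≤ 1 + g₁ ξ * g₁ ζ := by
    have := abs_le.1 (hosc ξ hξ ζ hζ)
    nlinarith [sq_nonneg (g₁ ξ + g₁ ζ), mul_nonneg (sub_nonneg.2 this.1) (sub_nonneg.2 this.2)]
  have e10 : |D| * (3 / 4) ≤ M * (2 * M * h ^ 2) := by
    calc |D| * (3 / 4) ≤ |D| * |1 + g₁ ξ * g₁ ζ| := by gcongr; exact e9.trans (le_abs_self _)
      _ = |g₁ ξ| * |e| := by rw [← abs_mul, e8, abs_neg, abs_mul]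
      _ ≤ _ := by gcongr; exact hM₁ ξ hξ
  nlinarith [abs_nonneg D, mul_nonneg (mul_nonneg hM hM) (sq_nonneg h)]

/-- The error of quadratic interpolation with the midnode on the perpendicular bisector. -/
lemma abs_quadArc_sub_le {g g₁ g₂ g₃ : ℝ → ℝ} {α β M h : ℝ} (hh0 : 0 ≤ h)
    (hd : ∀ x, HasDerivAt g (g₁ x) x) (hd₁ : ∀ x, HasDerivAt g₁ (g₂ x) x)
    (hd₂ : ∀ x, HasDerivAt g₂ (g₃ x) x)
    (hM : ∀ x ∈ Icc α β, |g₁ x| ≤ M ∧ |g₂ x| ≤ M ∧ |g₃ x| ≤ M)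
    (hosc : ∀ s ∈ Icc α β, ∀ t ∈ Icc α β, |g₁ s - g₁ t| ≤ 1)
    {x₀ m x₁ : ℝ} (hx₀ : x₀ ∈ Icc α β) (hm : m ∈ Icc α β) (hx₁ : x₁ ∈ Icc α β)
    (hne : x₀ ≠ x₁) (hh : |x₁ - x₀| ≤ h) (hh₀ : |x₀ - m| ≤ h) (hh₁ : |x₁ - m| ≤ h)
    (hdist : (m - x₀) ^ 2 + (g m - g x₀) ^ 2 = (m - x₁) ^ 2 + (g m - g x₁) ^ 2)
    (hX : ∀ t ∈ Icc (0 : ℝ) 1,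
      (1 - t) * (1 - 2 * t) * x₀ + 4 * t * (1 - t) * m + t * (2 * t - 1) * x₁ ∈ Icc α β)
    {t : ℝ} (ht : t ∈ Icc (0 : ℝ) 1) :
    |(1 - t) * (1 - 2 * t) * g x₀ + 4 * t * (1 - t) * g m + t * (2 * t - 1) * g x₁ -
      g ((1 - t) * (1 - 2 * t) * x₀ + 4 * t * (1 - t) * m + t * (2 * t - 1) * x₁)| ≤
      (216 * M + 216 * M ^ 3) * h ^ 3 := by
  have hM0 : 0 ≤ M := (abs_nonneg _).trans (hM _ hx₀).1
  have hD := abs_second_difference_le hd hd₁ (fun x hx => (hM x hx).1) (fun x hx => (hM x hx).2.1)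
    hosc hx₀ hm hx₁ hne hh hdist
  have hq : ∀ a b c t : ℝ, HasDerivAt
      (fun t : ℝ => (1 - t) * (1 - 2 * t) * a + 4 * t * (1 - t) * b + t * (2 * t - 1) * c)
      ((4 * t - 3) * a + (4 - 8 * t) * b + (4 * t - 1) * c) t := by
    intro a b c t
    have i := hasDerivAt_id t
    refine ((((i.const_sub 1).mul ((i.const_mul 2).const_sub 1)).mul_const a).add
      (((i.const_mul 4).mul (i.const_sub 1)).mul_const b) |>.add
      ((i.mul ((i.const_mul 2).sub_const 1)).mul_const c)).congr_deriv ?_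
    simp only [id]
    ring
  have hq' : ∀ a b c t : ℝ, HasDerivAt
      (fun t : ℝ => (4 * t - 3) * a + (4 - 8 * t) * b + (4 * t - 1) * c)
      (4 * (a - 2 * b + c)) t := by
    intro a b c t
    have i := hasDerivAt_id t
    refine (((((i.const_mul 4).sub_const 3).mul_const a).add
      (((i.const_mul 8).const_sub 4).mul_const b)).add
      (((i.const_mul 4).sub_const 1).mul_const c)).congr_deriv ?_
    ring
  set X : ℝ → ℝ := fun t =>
    (1 - t) * (1 - 2 * t) * x₀ + 4 * t * (1 - t) * m + t * (2 * t - 1) * x₁ with hXdef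
  set X' : ℝ → ℝ := fun t => (4 * t - 3) * x₀ + (4 - 8 * t) * m + (4 * t - 1) * x₁ with hX'def
  set D := x₀ - 2 * m + x₁ with hDdef
  have hX1 : ∀ t, HasDerivAt X (X' t) t := hq x₀ m x₁
  have hX2 : ∀ t, HasDerivAt X' (4 * D) t := hq' x₀ m x₁
  refine abs_le_of_three_zeros
    (f := fun t => (1 - t) * (1 - 2 * t) * g x₀ + 4 * t * (1 - t) * g m +
      t * (2 * t - 1) * g x₁ - g (X t))
    (f₁ := fun t => ((4 * t - 3) * g x₀ + (4 - 8 * t) * g m + (4 * t - 1) * g x₁) -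
      g₁ (X t) * X' t)
    (f₂ := fun t => 4 * (g x₀ - 2 * g m + g x₁) -
      (g₂ (X t) * X' t * X' t + g₁ (X t) * (4 * D)))
    (f₃ := fun t => -((g₃ (X t) * X' t * X' t + g₂ (X t) * (4 * D)) * X' t +
      g₂ (X t) * X' t * (4 * D) + g₂ (X t) * X' t * (4 * D)))
    (fun t => (hq _ _ _ t).sub ((hd _).comp t (hX1 t)))
    (fun t => (hq' _ _ _ t).sub (((hd₁ _).comp t (hX1 t)).mul (hX2 t)))
    (fun t => (((((hd₂ _).comp t (hX1 t)).mul (hX2 t)).mul (hX2 t)).add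
      (((hd₁ _).comp t (hX1 t)).mul_const _)).const_sub _) ?_ ?_ ?_ ?_ t ht
  · intro t ht
    obtain ⟨-, b2, b3⟩ := hM _ (hX t ht)
    have hX' : |X' t| ≤ 6 * h := by
      -- The coefficients of `X'` sum to zero, so `X'` is a combination of differences of nodes and
      -- is `O(h)`.
      have e : X' t = (4 * t - 3) * (x₀ - m) + (4 * t - 1) * (x₁ - m) := by rw [hX'def]; ring
      have c1 : |4 * t - 3| ≤ 3 := by rw [abs_le]; constructor <;> linarith [ht.1, ht.2]
      have c2 : |4 * t - 1| ≤ 3 := by rw [abs_le]; constructor <;> linarith [ht.1, ht.2]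
      calc |X' t| ≤ |4 * t - 3| * |x₀ - m| + |4 * t - 1| * |x₁ - m| := by
            rw [e, ← abs_mul, ← abs_mul]; exact abs_add_le _ _
        _ ≤ 3 * h + 3 * h := by gcongr
        _ = 6 * h := by ring
    -- Since `X''' = 0` and `X'' = 4D`, the third derivative of `g ∘ X` is `g₃ X'³ + 12 g₂ X' D`.
    -- Both terms are `O(h³)`, the second one because the midnode condition makes `D` of order `h²`.
    -- The two constants are `6³` and `12 · 6 · 3`, both `216`.
    have e : -((g₃ (X t) * X' t * X' t + g₂ (X t) * (4 * D)) * X' t +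
        g₂ (X t) * X' t * (4 * D) + g₂ (X t) * X' t * (4 * D)) =
        -(g₃ (X t) * X' t ^ 3 + 12 * (g₂ (X t) * (X' t * D))) := by ring
    rw [e, abs_neg]
    calc |g₃ (X t) * X' t ^ 3 + 12 * (g₂ (X t) * (X' t * D))|
        ≤ |g₃ (X t)| * |X' t| ^ 3 + 12 * (|g₂ (X t)| * (|X' t| * |D|)) := by
          refine (abs_add_le _ _).trans_eq ?_
          simp only [abs_mul, abs_pow]
          norm_num
      _ ≤ M * (6 * h) ^ 3 + 12 * (M * ((6 * h) * (3 * M ^ 2 * h ^ 2))) := by gcongr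
      _ = (216 * M + 216 * M ^ 3) * h ^ 3 := by ring
  · simp [hXdef]
  · have : X (1 / 2) = m := by simp only [hXdef]; ring
    simp only [this]; ring
  · have : X 1 = x₁ := by simp only [hXdef]; ring
    simp only [this]; ring

lemma dist_sq_of_ne {i j : Fin 2} (h : i ≠ j) (x y : Plane) :
    dist x y ^ 2 = (x i - y i) ^ 2 + (x j - y j) ^ 2 := by
  rw [EuclideanSpace.dist_eq, Real.sq_sqrt (by positivity), Fin.sum_univ_two]
  simp only [Real.dist_eq, sq_abs]
  rcases (by lia : (i = 0 ∧ j = 1) ∨ (i = 1 ∧ j = 0)) with ⟨rfl, rfl⟩ | ⟨rfl, rfl⟩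
  · rfl
  · ring

lemma mem_Icc_of_mem_box {z x : Plane} {r : ℝ} (h : x ∈ box z r) (k : Fin 2) :
    x k ∈ Icc (z k - r) (z k + r) := by
  have := abs_le.1 (h k)
  constructor <;> linarith [this.1, this.2]

section

variable {Ω Γ : Set Plane} {z : Plane} {r : ℝ} {i j : Fin 2} {g : ℝ → ℝ}

/-- In a chart, the discrete interface edges are close to the interface in the direction of the
coordinate number `j`. -/
lemma IsGraphChart.exists_edge_bound (H : IsGraphChart Ω Γ z r i j g) :
    ∃ C : ℝ, 0 ≤ C ∧ ∀ (s : ℕ) (_ : s = 1 ∨ s = 2) (h : ℝ) (_ : 0 ≤ h) (_ : h ≤ 1) (a b : Plane)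
      (_ : a ∈ Γ) (_ : b ∈ Γ) (_ : a ≠ b) (E : Set Plane) (_ : E ⊆ box z r)
      (_ : ∀ x ∈ E, ∀ y ∈ E, dist x y ≤ h) (_ : IsInterfaceEdge s Γ a b E),
      a ∈ E ∧ b ∈ E ∧ ∀ x ∈ E, |x j - g (x i)| ≤ C * h ^ (s + 1) := by
  obtain ⟨M, g₁, g₂, g₃, hM0, hg₁, hd, hd₁, hd₂, hM⟩ :=
    exists_deriv_bounds H.contDiff (z i - r) (z i + r)
  have hosc := H.osc
  rw [← hg₁] at hosc
  refine ⟨(216 * M + 216 * M ^ 3) + M, by positivity, ?_⟩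
  intro s hs h hh0 hh1 a b ha hb hab E hE hdiam hedge
  -- On a graph, distinct points have distinct coordinates number `i`.
  have hne : ∀ {x y : Plane}, x ∈ Γ → y ∈ Γ → x ∈ E → y ∈ E → x ≠ y → x i ≠ y i := by
    intro x y hx hy hxE hyE hxy he
    refine hxy (ext_of_ne H.ne he ?_)
    rw [H.eq x hx (hE hxE), H.eq y hy (hE hyE), he]
  have hcoord : ∀ x ∈ E, ∀ y ∈ E, |x i - y i| ≤ h := fun x hx y hy =>
    (abs_apply_sub_le_dist x y i).trans (hdiam x hx y hy)
  rcases hedge with ⟨m, hm, hdist, rfl⟩ | ⟨rfl, rfl⟩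
  · set q : ℝ → Plane := fun t : ℝ =>
      ((1 - t) * (1 - 2 * t)) • a + (4 * t * (1 - t)) • m + (t * (2 * t - 1)) • b with hq
    have hqE : ∀ t ∈ Icc (0 : ℝ) 1, q t ∈ quadArc a m b := fun t ht => ⟨t, ht, rfl⟩
    have haE : a ∈ quadArc a m b := by
      have := hqE 0 (by simp)
      simpa [hq] using this
    have hbE : b ∈ quadArc a m b := by
      have := hqE 1 (by simp)
      have e : q 1 = b := by simp only [hq]; norm_num
      rwa [e] at this
    have hmE : m ∈ quadArc a m b := by
      have := hqE (1 / 2) ⟨by norm_num, by norm_num⟩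
      have e : q (1 / 2) = m := by simp only [hq]; norm_num
      rwa [e] at this
    refine ⟨haE, hbE, ?_⟩
    rintro x ⟨t, ht, rfl⟩
    have ea := H.eq a ha (hE haE)
    have eb := H.eq b hb (hE hbE)
    have em := H.eq m hm (hE hmE)
    have hdist2 : (m i - a i) ^ 2 + (g (m i) - g (a i)) ^ 2 =
        (m i - b i) ^ 2 + (g (m i) - g (b i)) ^ 2 := by
      rw [← ea, ← eb, ← em, ← dist_sq_of_ne H.ne, ← dist_sq_of_ne H.ne, hdist]
    have key := abs_quadArc_sub_le hh0 hd hd₁ hd₂ hM hosc (mem_Icc_of_mem_box (hE haE) i)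
      (mem_Icc_of_mem_box (hE hmE) i) (mem_Icc_of_mem_box (hE hbE) i) (hne ha hb haE hbE hab)
      (hcoord b hbE a haE) (hcoord a haE m hmE) (hcoord b hbE m hmE) hdist2
      (fun t ht => by simpa [hq] using mem_Icc_of_mem_box (hE (hqE t ht)) i) ht
    rw [← ea, ← eb, ← em] at key
    -- A quadratic edge may also occur where only order one is required; as `h ≤ 1`, its better
    -- bound implies the weaker one.
    have h3 : h ^ 3 ≤ h ^ (s + 1) := pow_le_pow_of_le_one hh0 hh1 (by lia)
    calc _ ≤ (216 * M + 216 * M ^ 3) * h ^ 3 := by simpa using key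
      _ ≤ ((216 * M + 216 * M ^ 3) + M) * h ^ (s + 1) := by
        exact mul_le_mul (by linarith) h3 (by positivity) (by positivity)
  · have haE := left_mem_segment ℝ a b
    have hbE := right_mem_segment ℝ a b
    refine ⟨haE, hbE, ?_⟩
    intro x hx
    rw [segment_eq_image] at hx
    obtain ⟨t, ht, rfl⟩ := hx
    have ea := H.eq a ha (hE haE)
    have eb := H.eq b hb (hE hbE)
    have key := abs_segment_sub_le hd hd₁ (fun x hx => (hM x hx).2.1)
      (mem_Icc_of_mem_box (hE haE) i) (mem_Icc_of_mem_box (hE hbE) i) ht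
    rw [← ea, ← eb] at key
    have h2 : (b i - a i) ^ 2 ≤ h ^ 2 := by
      have := hcoord b hbE a haE
      rw [← sq_abs]
      gcongr
    calc _ ≤ M * (b i - a i) ^ 2 := by simpa using key
      _ ≤ M * h ^ 2 := by gcongr
      _ ≤ ((216 * M + 216 * M ^ 3) + M) * h ^ (1 + 1) := by
        have : 0 ≤ 216 * M + 216 * M ^ 3 := by positivity
        norm_num
        gcongr
        linarith

lemma IsGraphChart.exists_patchInterface_bound (H : IsGraphChart Ω Γ z r i j g) :
    ∃ C : ℝ, 0 ≤ C ∧ ∀ (s : ℕ) (_ : s = 1 ∨ s = 2) (h : ℝ) (_ : 0 ≤ h) (_ : h ≤ 1) (a b : Plane)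
      (_ : a ∈ Γ) (_ : b ∈ Γ) (_ : a ≠ b) (G : Set Plane) (_ : G ⊆ box z r)
      (_ : ∀ x ∈ G, ∀ y ∈ G, dist x y ≤ h) (_ : IsPatchInterface s Γ a b G),
      ∀ x ∈ G, |x j - g (x i)| ≤ C * h ^ (s + 1) := by
  obtain ⟨C, hC, hE⟩ := H.exists_edge_bound
  refine ⟨C, hC, ?_⟩
  intro s hs h hh0 hh1 a b ha hb hab G hG hdiam hint
  rcases hint with hedge | ⟨x, hx, hxa, hxb, E₁, E₂, h₁, h₂, rfl⟩
  · exact (hE s hs h hh0 hh1 a b ha hb hab G hG hdiam hedge).2.2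
  · have b1 := (hE s hs h hh0 hh1 a x ha hx hxa.symm E₁ (subset_union_left.trans hG)
      (fun u hu v hv => hdiam u (Or.inl hu) v (Or.inl hv)) h₁).2.2
    have b2 := (hE s hs h hh0 hh1 x b hx hb hxb E₂ (subset_union_right.trans hG)
      (fun u hu v hv => hdiam u (Or.inr hu) v (Or.inr hv)) h₂).2.2
    rintro y (hy | hy)
    exacts [b1 y hy, b2 y hy]

/-! ### Traces of first derivatives in strips around the interface -/

/-- The part of a chart at distance at most `δ` from the graph. -/
def strip (z : Plane) (r : ℝ) (i j : Fin 2) (g : ℝ → ℝ) (δ : ℝ) : Set Plane :=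
  {x | x ∈ box z r ∧ |x j - g (x i)| ≤ δ}

lemma strip_subset_box (δ : ℝ) : strip z r i j g δ ⊆ box z r := fun _ h => h.1

lemma strip_mono {δ δ' : ℝ} (h : δ ≤ δ') : strip z r i j g δ ⊆ strip z r i j g δ' :=
  fun _ hx => ⟨hx.1, hx.2.trans h⟩

lemma measurableSet_strip (hg : Continuous g) (δ : ℝ) : MeasurableSet (strip z r i j g δ) :=
  ((isClosed_box z r).inter (isClosed_le (f := fun x : Plane => |x j - g (x i)|)
    (by fun_prop) continuous_const)).measurableSet

lemma volume_slice_strip_le (hij : i ≠ j) (δ s : ℝ) :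
    volume {t | coordMap i (s, t) ∈ strip z r i j g δ} ≤ ENNReal.ofReal (2 * δ) := by
  have : {t | coordMap i (s, t) ∈ strip z r i j g δ} ⊆ Icc (g s - δ) (g s + δ) := by
    rintro t ⟨-, ht⟩
    rw [coordMap_same, coordMap_other hij, abs_le] at ht
    exact ⟨by linarith [ht.1], by linarith [ht.2]⟩
  refine (measure_mono this).trans_eq ?_
  rw [Real.volume_Icc]
  congr 1
  ring

/-- The trace estimate for first derivatives of `H²` functions in a strip. -/
theorem IsGraphChart.exists_sqInt_strip_le (H : IsGraphChart Ω Γ z r i j g) (hΩ : IsOpen Ω) :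
    ∃ K : NNReal, ∀ (f : Plane → ℝ) (_ : MemSobolev Ω 3 f) (I : Fin 1 → Fin 2) (δ : ℝ),
      sqInt (strip z r i j g δ) (weakDeriv Ω I f) ≤
        K * ENNReal.ofReal δ * ENNReal.ofReal (sobolevNorm Ω 2 f ^ 2) := by
  obtain ⟨K, hK⟩ := exists_sqInt_thin_le hΩ H.pos H.box_subset H.ne
  -- One factor `2` is the width `2δ` of the strip, the other counts the two terms bounded by the
  -- `H²` norm.
  refine ⟨4 * K, fun f hf I δ => ?_⟩
  have hp := (hf.hasWeakDeriv (by norm_num) I).hasWeakPartial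
    (hf.hasWeakDeriv (by norm_num) (Fin.snoc I j : Fin 2 → Fin 2))
  refine (hK _ _ hp _ (measurableSet_strip H.contDiff.continuous δ) _ (strip_subset_box δ)
    (volume_slice_strip_le H.ne δ)).trans ?_
  have b1 := hf.sqInt_le hΩ (l := 2) (by norm_num) (by norm_num) I
  have b2 := hf.sqInt_le hΩ (l := 2) (by norm_num) (by norm_num) (Fin.snoc I j : Fin 2 → Fin 2)
  rw [ENNReal.ofReal_mul (by norm_num)]
  calc _ ≤ K * (ENNReal.ofReal 2 * ENNReal.ofReal δ) *
        (ENNReal.ofReal (sobolevNorm Ω 2 f ^ 2) + ENNReal.ofReal (sobolevNorm Ω 2 f ^ 2)) := by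
        gcongr
    _ = _ := by
        rw [ENNReal.ofReal_ofNat]; push_cast; ring

/-- The trace estimate for first derivatives of `H³` functions in a short piece of a strip. -/
theorem IsGraphChart.exists_sqInt_short_strip_le (H : IsGraphChart Ω Γ z r i j g)
    (hΩ : IsOpen Ω) :
    ∃ K : NNReal, ∀ (f : Plane → ℝ) (_ : MemSobolev Ω 3 f) (I : Fin 1 → Fin 2) (δ α h : ℝ),
      sqInt (strip z r i j g δ ∩ {x | x i ∈ Icc (α - h) (α + h)}) (weakDeriv Ω I f) ≤
        K * (ENNReal.ofReal δ * ENNReal.ofReal h) * ENNReal.ofReal (sobolevNorm Ω 3 f ^ 2) := by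
  obtain ⟨K, hK⟩ := exists_sqInt_small_le hΩ H.pos H.box_subset H.ne
  refine ⟨16 * K, fun f hf I δ α h => ?_⟩
  have hD := fun (n : ℕ) (hn : n ≤ 3) (J : Fin n → Fin 2) => hf.hasWeakDeriv hn J
  have hi := (hD 1 (by norm_num) I).hasWeakPartial
    (hD 2 (by norm_num) (Fin.snoc I i : Fin 2 → Fin 2))
  have hj := (hD 1 (by norm_num) I).hasWeakPartial
    (hD 2 (by norm_num) (Fin.snoc I j : Fin 2 → Fin 2))
  have hji := (hD 2 (by norm_num) (Fin.snoc I j : Fin 2 → Fin 2)).hasWeakPartial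
    (hD 3 (by norm_num) (Fin.snoc (Fin.snoc I j : Fin 2 → Fin 2) i : Fin 3 → Fin 2))
  have hm : MeasurableSet (strip z r i j g δ ∩ {x | x i ∈ Icc (α - h) (α + h)}) :=
    (measurableSet_strip H.contDiff.continuous δ).inter
      (measurableSet_preimage (by fun_prop) measurableSet_Icc)
  refine (hK _ _ _ _ hi hj hji _ hm (Icc (α - h) (α + h)) measurableSet_Icc
    (ENNReal.ofReal (2 * δ)) (inter_subset_left.trans (strip_subset_box δ)) (fun x hx => hx.2)
    (fun s => (measure_mono fun t ht => ht.1).trans (volume_slice_strip_le H.ne δ s))).trans ?_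
  have b := fun (n : ℕ) (hn : n ≤ 3) (J : Fin n → Fin 2) => hf.sqInt_le hΩ hn le_rfl J
  have hvol : volume (Icc (α - h) (α + h)) = ENNReal.ofReal 2 * ENNReal.ofReal h := by
    rw [Real.volume_Icc, ← ENNReal.ofReal_mul (by norm_num)]
    congr 1
    ring
  rw [hvol, ENNReal.ofReal_mul (by norm_num : (0 : ℝ) ≤ 2)]
  set N := ENNReal.ofReal (sobolevNorm Ω 3 f ^ 2)
  calc _ ≤ K * (ENNReal.ofReal 2 * ENNReal.ofReal δ * (ENNReal.ofReal 2 * ENNReal.ofReal h)) *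
        (N + N + (N + N)) := by
        gcongr
        exacts [b 1 (by norm_num) _, b 2 (by norm_num) _, b 2 (by norm_num) _, b 3 le_rfl _]
    _ = _ := by
        rw [ENNReal.ofReal_ofNat]; push_cast; ring

end

/-! ### The discrete subdomains -/

/-- The open sets are disjoint, so a point in both closures lies in neither set and is a frontier
point of both. -/
lemma IsInterfaceSplitting.closure_inter_subset {Ω : Set Plane} {Ωs : Fin 2 → Set Plane}
    (h : IsInterfaceSplitting Ω Ωs) : closure (Ωs 0) ∩ closure (Ωs 1) ⊆ interface Ωs := by
  rintro y ⟨h0, h1⟩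
  refine ⟨⟨h0, ?_⟩, ⟨h1, ?_⟩⟩
  · rw [(h.isOpen_sub 0).interior_eq]
    exact fun hy => (h.disjoint_sub.closure_right (h.isOpen_sub 0)).le_bot ⟨hy, h1⟩
  · rw [(h.isOpen_sub 1).interior_eq]
    exact fun hy => (h.disjoint_sub.closure_left (h.isOpen_sub 1)).le_bot ⟨h0, hy⟩

lemma IsInterfaceSplitting.disjoint_closure {Ω : Set Plane} {Ωs : Fin 2 → Set Plane}
    (h : IsInterfaceSplitting Ω Ωs) {i k : Fin 2} (hik : i ≠ k) :
    Disjoint (Ωs i) (closure (Ωs k)) := by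
  refine Disjoint.closure_right ?_ (h.isOpen_sub i)
  rcases (by lia : (i = 0 ∧ k = 1) ∨ (i = 1 ∧ k = 0)) with ⟨rfl, rfl⟩ | ⟨rfl, rfl⟩
  exacts [h.disjoint_sub, h.disjoint_sub.symm]

lemma IsInterfaceSplitting.interface_subset {Ω : Set Plane} {Ωs : Fin 2 → Set Plane}
    (h : IsInterfaceSplitting Ω Ωs) : interface Ωs ⊆ Ω := by
  rw [h.union_eq]
  exact fun x hx => Or.inl (Or.inr hx)

lemma IsInterfaceSplitting.sub_subset {Ω : Set Plane} {Ωs : Fin 2 → Set Plane}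
    (h : IsInterfaceSplitting Ω Ωs) (i : Fin 2) : Ωs i ⊆ Ω := by
  rw [h.union_eq]
  rcases (by lia : i = 0 ∨ i = 1) with rfl | rfl
  exacts [fun x hx => Or.inl (Or.inl hx), fun x hx => Or.inr hx]

lemma continuous_polyMap (F : Fin 2 → MvPolynomial (Fin 2) ℝ) : Continuous (polyMap F) := by
  refine (PiLp.continuous_toLp 2 _).comp (continuous_pi fun i => ?_)
  exact (MvPolynomial.continuous_eval (F i)).comp (by fun_prop)

lemma isCompact_refSquare : IsCompact refSquare := by
  refine (isCompact_closedBall (0 : Plane) 2).of_isClosed_subset ?_ ?_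
  · simp only [refSquare, ofPred_forall]
    refine isClosed_iInter fun i => ?_
    exact (isClosed_le (f := fun _ : Plane => (0 : ℝ)) continuous_const (by fun_prop)).inter
      (isClosed_le (f := fun x : Plane => x i) (by fun_prop) continuous_const)
  · refine fun x hx => box_subset_closedBall 0 1 (fun k => ?_) |> fun h => by simpa using h
    have := hx k
    simp only [PiLp.zero_apply, sub_zero, abs_le]
    constructor <;> linarith [this.1, this.2]

lemma isCompact_refTriangle : IsCompact refTriangle := by
  refine isCompact_refSquare.of_isClosed_subset ?_ ?_
  · exact (isClosed_le (f := fun _ : Plane => (0 : ℝ)) continuous_const (by fun_prop)).inter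
      ((isClosed_le (f := fun _ : Plane => (0 : ℝ)) continuous_const (by fun_prop)).inter
      (isClosed_le (f := fun x : Plane => x 0 + x 1) (by fun_prop) continuous_const))
  · rintro x ⟨h0, h1, h2⟩ i
    rcases (by lia : i = 0 ∨ i = 1) with rfl | rfl <;> constructor <;> linarith

lemma PatchMesh.isCompact_patch {Ω : Set Plane} (M : PatchMesh Ω) (p : Fin M.numPatches) :
    IsCompact (M.patch p) :=
  (finite_range _).isCompact_convexHull ℝ

lemma PatchMesh.convex_patch {Ω : Set Plane} (M : PatchMesh Ω) (p : Fin M.numPatches) :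
    Convex ℝ (M.patch p) :=
  convex_convexHull ℝ _

lemma PatchMesh.interior_patch_subset {Ω : Set Plane} (M : PatchMesh Ω) (p : Fin M.numPatches) :
    interior (M.patch p) ⊆ Ω := by
  refine (interior_mono ?_).trans M.cover.symm.subset
  exact subset_iUnion (fun p => convexHull ℝ (range (M.vertex p))) p

lemma PatchMesh.dist_le_meshSize {Ω : Set Plane} (M : PatchMesh Ω) {p : Fin M.numPatches}
    {x y : Plane} (hx : x ∈ M.patch p) (hy : y ∈ M.patch p) : dist x y ≤ M.meshSize :=
  (Metric.dist_le_diam_of_mem (M.isCompact_patch p).isBounded hx hy).trans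
    (le_ciSup (f := fun p => Metric.diam (M.patch p)) (finite_range _).bddAbove p)

lemma PatchMesh.meshSize_nonneg {Ω : Set Plane} (M : PatchMesh Ω) : 0 ≤ M.meshSize :=
  Real.iSup_nonneg fun _ => Metric.diam_nonneg

namespace FittedMesh

variable {Ω : Set Plane} {Ωs : Fin 2 → Set Plane} {M : PatchMesh Ω} (T : FittedMesh Ωs M)

/-- The part of the patch `p` that belongs to the discrete subdomain number `i`. -/
def part (p : Fin M.numPatches) (i : Fin 2) : Set Plane := ⋃ K ∈ T.cells p i, K

lemma isCompact_cell {p : Fin M.numPatches} {i : Fin 2} {K : Set Plane} (hK : K ∈ T.cells p i) :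
    IsCompact K := by
  rcases T.split p with ⟨-, h⟩ | ⟨-, h⟩
  · obtain ⟨F, -, -, rfl⟩ := h i K hK
    exact isCompact_refSquare.image (continuous_polyMap F)
  · obtain ⟨F, -, -, rfl⟩ := h i K hK
    exact isCompact_refTriangle.image (continuous_polyMap F)

lemma isClosed_part (p : Fin M.numPatches) (i : Fin 2) : IsClosed (T.part p i) :=
  (T.cells p i).finite_toSet.isClosed_biUnion fun _ hK => (T.isCompact_cell hK).isClosed

lemma part_union (p : Fin M.numPatches) : T.part p 0 ∪ T.part p 1 = M.patch p := by
  rw [← T.cover p]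
  ext x
  simp [part, Fin.exists_fin_two]

lemma cell_subset {p : Fin M.numPatches} {i : Fin 2} {K : Set Plane} (hK : K ∈ T.cells p i) :
    K ⊆ M.patch p := by
  rw [← T.cover p]
  exact fun x hx => mem_iUnion.2 ⟨i, mem_biUnion hK hx⟩

lemma part_subset (p : Fin M.numPatches) (i : Fin 2) : T.part p i ⊆ M.patch p :=
  iUnion₂_subset fun _ hK => T.cell_subset hK

lemma isOpen_sub (i : Fin 2) : IsOpen (T.sub i) := isOpen_interior

lemma sub_subset (i : Fin 2) : T.sub i ⊆ Ω :=
  (interior_mono (iUnion_mono fun p => T.part_subset p i)).trans M.cover.symm.subset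

/-- Together with the complement of `W`, the family is a finite closed cover of the space, so by
Baire the interiors of its members are dense; the interior of the complement does not meet `W`. -/
lemma exists_interior_inter_nonempty {X : Type*} [TopologicalSpace X] [BaireSpace X]
    {F : Set (Set X)} (hF : F.Finite) (hc : ∀ K ∈ F, IsClosed K) {W : Set X} (hW : IsOpen W)
    (hne : W.Nonempty) (hsub : W ⊆ ⋃₀ F) : ∃ K ∈ F, (W ∩ interior K).Nonempty := by
  have hd := dense_sUnion_interior_of_closed (S := insert Wᶜ F)
    (by
      rintro K (rfl | hK)
      exacts [hW.isClosed_compl, hc K hK])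
    (hF.insert _).countable
    (by
      rw [sUnion_insert, eq_univ_iff_forall]
      intro x
      by_cases hx : x ∈ W
      exacts [Or.inr (hsub hx), Or.inl hx])
  obtain ⟨x, hxW, hx⟩ := hd.inter_open_nonempty W hW hne
  obtain ⟨K, hK, hxK⟩ := mem_iUnion₂.1 hx
  rcases hK with rfl | hK
  · exact absurd hxW (interior_subset hxK)
  · exact ⟨K, hK, x, hxW, hxK⟩

/-- The discrete subdomains are interiors of closed unions, while only single elements are known to
have disjoint interiors. If the subdomains met, two applications of the Baire argument would find a
point interior to an element of each kind. -/
lemma disjoint_sub : Disjoint (T.sub 0) (T.sub 1) := by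
  rw [Set.disjoint_iff_inter_eq_empty]
  by_contra hne
  have hne := nonempty_iff_ne_empty.2 hne
  have hfin : ∀ i, {K | ∃ p, K ∈ T.cells p i}.Finite := by
    intro i
    have : {K | ∃ p, K ∈ T.cells p i} = ⋃ p, (T.cells p i : Set (Set Plane)) := by
      ext; simp
    rw [this]
    exact finite_iUnion fun p => (T.cells p i).finite_toSet
  have hcl : ∀ i, ∀ K ∈ {K | ∃ p, K ∈ T.cells p i}, IsClosed K := by
    rintro i K ⟨p, hK⟩
    exact (T.isCompact_cell hK).isClosed
  have hcov : ∀ i, T.sub i ⊆ ⋃₀ {K | ∃ p, K ∈ T.cells p i} := by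
    intro i x hx
    obtain ⟨p, hp⟩ := mem_iUnion.1 (interior_subset hx)
    obtain ⟨K, hK, hxK⟩ := mem_iUnion₂.1 hp
    exact ⟨K, ⟨p, hK⟩, hxK⟩
  obtain ⟨K, ⟨p, hK⟩, hW⟩ := exists_interior_inter_nonempty (hfin 0) (hcl 0)
    ((T.isOpen_sub 0).inter (T.isOpen_sub 1)) hne (inter_subset_left.trans (hcov 0))
  obtain ⟨K', ⟨p', hK'⟩, x, hx, hxK'⟩ := exists_interior_inter_nonempty (hfin 1) (hcl 1)
    (((T.isOpen_sub 0).inter (T.isOpen_sub 1)).inter isOpen_interior) hW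
    ((inter_subset_left.trans inter_subset_right).trans (hcov 1))
  by_cases hpp : p = p'
  · subst hpp
    have hKK : K ≠ K' := by
      rintro rfl
      exact Finset.disjoint_left.1 (T.cells_disjoint p) hK hK'
    exact (T.interior_disjoint p 0 1 K hK K' hK' hKK).le_bot ⟨hx.2, hxK'⟩
  · exact (M.interior_disjoint p p' hpp).le_bot
      ⟨interior_mono (T.cell_subset hK) hx.2, interior_mono (T.cell_subset hK') hxK'⟩

/-- The points where exact and discrete subdomain disagree lie in the interior of a cut patch. -/
lemma exists_cut_of_mem (hΩ : IsInterfaceSplitting Ω Ωs) {i k : Fin 2} (hik : i ≠ k) {x : Plane}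
    (hx : x ∈ Ωs i) (hxk : x ∈ T.sub k) :
    ∃ p, M.IsCut (interface Ωs) p ∧ x ∈ interior (M.patch p) ∧ x ∈ T.part p k := by
  obtain ⟨p, hp⟩ := mem_iUnion.1 (interior_subset hxk)
  obtain ⟨K, hK, hxK⟩ := mem_iUnion₂.1 hp
  have hnot : x ∉ closure (Ωs k) := fun h => (hΩ.disjoint_closure hik).le_bot ⟨hx, h⟩
  have hcut : M.IsCut (interface Ωs) p := by
    by_contra hcut
    exact hnot (T.not_cut p hcut k K hK hxK)
  refine ⟨p, hcut, ?_, hp⟩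
  by_contra hint
  have hfr : x ∈ frontier (M.patch p) := ⟨subset_closure (T.cell_subset hK hxK), hint⟩
  exact hnot (T.boundary p hcut k K hK ⟨hxK, hfr⟩)

end FittedMesh

/-- The segment of length `|R| + 1` leaves the bounded set; being connected, it meets both `P` and
the closure of the complement in a common point. -/
lemma exists_mem_frontier_ray {P : Set Plane} (hP : IsCompact P) {x e : Plane}
    (hx : x ∈ interior P) (he : e ≠ 0) : ∃ t : ℝ, 0 < t ∧ x + t • e ∈ frontier P := by
  obtain ⟨R, hR⟩ := hP.isBounded.subset_closedBall x
  set L : ℝ := (|R| + 1) / ‖e‖ with hL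
  have he' : 0 < ‖e‖ := norm_pos_iff.2 he
  have hL0 : 0 < L := by positivity
  have hout : x + L • e ∉ P := by
    intro h
    have := hR h
    rw [Metric.mem_closedBall, dist_eq_norm, add_sub_cancel_left, norm_smul, Real.norm_eq_abs,
      abs_of_pos hL0, hL, div_mul_cancel₀ _ he'.ne'] at this
    linarith [le_abs_self R]
  have hpre : IsPreconnected ((fun t : ℝ => x + t • e) '' Icc 0 L) :=
    isPreconnected_Icc.image _ (by fun_prop)
  obtain ⟨y, ⟨t, ht, rfl⟩, hy1, hy2⟩ := isPreconnected_closed_iff.1 hpre P (closure Pᶜ)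
    hP.isClosed isClosed_closure
    (fun y _ => (em (y ∈ P)).imp id fun h => subset_closure h)
    ⟨x, ⟨0, ⟨le_rfl, hL0.le⟩, by simp⟩, interior_subset hx⟩
    ⟨x + L • e, ⟨L, ⟨hL0.le, le_rfl⟩, rfl⟩, subset_closure hout⟩
  have hy : x + t • e ∈ frontier P := by
    rw [frontier_eq_closure_inter_closure]
    exact ⟨subset_closure hy1, hy2⟩
  refine ⟨t, ht.1.lt_of_ne ?_, hy⟩
  rintro rfl
  exact hy.2 (by simpa using hx)

/-- In a patch within a chart, the points where exact and discrete subdomain disagree are at most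
as far from the interface as the discrete interface. -/
lemma FittedMesh.mem_strip {Ω : Set Plane} {Ωs : Fin 2 → Set Plane} {M : PatchMesh Ω}
    (T : FittedMesh Ωs M) (hΩ : IsInterfaceSplitting Ω Ωs) {z : Plane} {r : ℝ} {i j : Fin 2}
    {g : ℝ → ℝ} (H : IsGraphChart Ω (interface Ωs) z r i j g) {p : Fin M.numPatches}
    (hcut : M.IsCut (interface Ωs) p) (hbox : M.patch p ⊆ box z r) {δ : ℝ} (hδ : 0 ≤ δ)
    (hG : ∀ x ∈ T.part p 0 ∩ T.part p 1, |x j - g (x i)| ≤ δ) {l k : Fin 2} (hlk : l ≠ k)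
    {x : Plane} (hxl : x ∈ Ωs l) (hxi : x ∈ interior (M.patch p)) (hxk : x ∈ T.part p k) :
    x ∈ strip z r i j g δ := by
  refine ⟨hbox (interior_subset hxi), ?_⟩
  by_contra hcon
  -- The sign `σ` records the side of the graph. Moving in direction `σ e_j` keeps `x i` fixed and
  -- only increases the distance to the graph, so the path `c` below meets neither `Γ` nor the
  -- discrete interface.
  obtain ⟨σ, hσ, hσx⟩ : ∃ σ : ℝ, (σ = 1 ∨ σ = -1) ∧ δ < σ * (x j - g (x i)) := by
    rw [not_le, lt_abs] at hcon
    rcases hcon with h | h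
    · exact ⟨1, Or.inl rfl, by simpa using h⟩
    · exact ⟨-1, Or.inr rfl, by simpa using h⟩
  have hσ2 : σ * σ = 1 := by rcases hσ with rfl | rfl <;> norm_num
  have hσa : |σ| = 1 := by rcases hσ with rfl | rfl <;> norm_num
  set e : Plane := EuclideanSpace.single j σ with he
  have he0 : e ≠ 0 := by
    intro h
    have := congrArg (fun v : Plane => v j) h
    simp [he] at this
    rw [this] at hσ2
    norm_num at hσ2
  obtain ⟨t, ht, hy⟩ := exists_mem_frontier_ray (M.isCompact_patch p) hxi he0
  set c : ℝ → Plane := fun s => x + (s * t) • e with hc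
  have hcc : Continuous c := by fun_prop
  have hyc : c 1 = x + t • e := by simp [hc]
  have hxc : c 0 = x := by simp [hc]
  have hfar : ∀ s, 0 ≤ s → δ < |c s j - g (c s i)| := by
    intro s hs
    have e1 : c s i = x i := by simp [hc, he, H.ne]
    have e2 : c s j = x j + s * t * σ := by simp [hc, he]
    rw [e1, e2]
    have : σ * (x j + s * t * σ - g (x i)) = σ * (x j - g (x i)) + s * t := by
      linear_combination s * t * hσ2
    calc δ < σ * (x j + s * t * σ - g (x i)) := by rw [this]; nlinarith [mul_nonneg hs ht.le]
      _ ≤ |σ * (x j + s * t * σ - g (x i))| := le_abs_self _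
      _ = _ := by rw [abs_mul, hσa, one_mul]
  have hcl := (M.isCompact_patch p).isClosed
  have hyP : c 1 ∈ M.patch p := by rw [hyc]; exact hcl.frontier_subset hy
  have hint : ∀ s ∈ Ico (0 : ℝ) 1, c s ∈ interior (M.patch p) := by
    intro s hs
    rcases hs.1.eq_or_lt with h | h
    · rw [← h, hxc]; exact hxi
    · refine (M.convex_patch p).openSegment_interior_self_subset_interior hxi hyP ?_
      rw [openSegment_eq_image']
      refine ⟨s, ⟨h, hs.2⟩, ?_⟩
      simp [hc, smul_smul]
  have hcP : ∀ s ∈ Icc (0 : ℝ) 1, c s ∈ M.patch p := by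
    intro s hs
    rcases hs.2.eq_or_lt with h | h
    · rw [h]; exact hyP
    · exact interior_subset (hint s ⟨hs.1, h⟩)
  have hcG : ∀ s ∈ Icc (0 : ℝ) 1, c s ∉ interface Ωs := by
    intro s hs h
    have h1 := H.eq _ h (hbox (hcP s hs))
    have h2 := hfar s hs.1
    rw [h1, sub_self, abs_zero] at h2
    linarith
  have hpre : IsPreconnected (c '' Icc 0 1) := isPreconnected_Icc.image _ hcc.continuousOn
  -- The two parts are closed and cover the path; were the end point outside part `k`, by
  -- connectedness the path would cross the discrete interface, at distance more than `δ` from the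
  -- graph.
  have hyk : c 1 ∈ T.part p k := by
    by_contra hyk
    have hcov : ∀ s ∈ Icc (0 : ℝ) 1, c s ∈ T.part p k ∪ T.part p l := by
      intro s hs
      have := hcP s hs
      rw [← T.part_union p] at this
      rcases (by lia : (l = 0 ∧ k = 1) ∨ (l = 1 ∧ k = 0)) with ⟨rfl, rfl⟩ | ⟨rfl, rfl⟩
      exacts [this.symm, this]
    obtain ⟨w, ⟨s, hs, rfl⟩, hw1, hw2⟩ := isPreconnected_closed_iff.1 hpre _ _
      (T.isClosed_part p k) (T.isClosed_part p l) (by rintro _ ⟨s, hs, rfl⟩; exact hcov s hs)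
      ⟨c 0, ⟨0, by simp, rfl⟩, by rw [hxc]; exact hxk⟩
      ⟨c 1, ⟨1, by simp, rfl⟩, (hcov 1 (by simp)).resolve_left hyk⟩
    refine (hG (c s) ?_).not_gt (hfar s hs.1)
    rcases (by lia : (l = 0 ∧ k = 1) ∨ (l = 1 ∧ k = 0)) with ⟨rfl, rfl⟩ | ⟨rfl, rfl⟩
    exacts [⟨hw2, hw1⟩, ⟨hw1, hw2⟩]
  have hyk' : c 1 ∈ closure (Ωs k) := by
    obtain ⟨K, hK, hyK⟩ := mem_iUnion₂.1 hyk
    exact T.boundary p hcut k K hK ⟨hyK, by rw [hyc]; exact hy⟩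
  have hyl : c 1 ∈ closure (Ωs l) := by
    -- The end point is left out, since a boundary point of the patch may lie on the boundary of
    -- `Ω`. The half-open path stays in `Ω` and avoids `Γ`, hence stays in `Ωs l`; the end point is
    -- then in the closure.
    have hsub : c '' Ico 0 1 ⊆ Ωs l := by
      refine (isPreconnected_Ico.image _ hcc.continuousOn).subset_left_of_subset_union
        (hΩ.isOpen_sub l) (hΩ.isOpen_sub k)
        ((hΩ.disjoint_closure hlk).mono_right subset_closure) ?_
        ⟨c 0, ⟨0, by simp, rfl⟩, by rw [hxc]; exact hxl⟩
      rintro _ ⟨s, hs, rfl⟩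
      have h1 := M.interior_patch_subset p (hint s hs)
      have h2 := hcG s (Ico_subset_Icc_self hs)
      rw [hΩ.union_eq] at h1
      rcases (by lia : (l = 0 ∧ k = 1) ∨ (l = 1 ∧ k = 0)) with ⟨rfl, rfl⟩ | ⟨rfl, rfl⟩ <;>
        rcases h1 with (h1 | h1) | h1
      exacts [Or.inl h1, absurd h1 h2, Or.inr h1, Or.inr h1, absurd h1 h2, Or.inl h1]
    have h1 : c 1 ∈ c '' closure (Ico 0 1) := by
      rw [closure_Ico zero_ne_one]
      exact ⟨1, by simp, rfl⟩
    exact closure_mono hsub (image_closure_subset_closure_image hcc h1)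
  refine hcG 1 (by simp) (hΩ.closure_inter_subset ?_)
  rcases (by lia : (l = 0 ∧ k = 1) ∨ (l = 1 ∧ k = 0)) with ⟨rfl, rfl⟩ | ⟨rfl, rfl⟩
  exacts [⟨hyl, hyk'⟩, ⟨hyk', hyl⟩]

/-! ### Integrals over the mismatch set -/

lemma sqInt_union_le (A B : Set Plane) (f : Plane → ℝ) :
    sqInt (A ∪ B) f ≤ sqInt A f + sqInt B f :=
  lintegral_union_le _ _ _

lemma sqInt_biUnion_le {ι : Type*} (t : Finset ι) (A : ι → Set Plane) (f : Plane → ℝ) :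
    sqInt (⋃ z ∈ t, A z) f ≤ ∑ z ∈ t, sqInt (A z) f := by
  classical
  induction t using Finset.induction_on with
  | empty => simp [sqInt]
  | insert a s ha ih =>
    rw [Finset.sum_insert ha, Finset.set_biUnion_insert]
    exact (sqInt_union_le _ _ _).trans (by gcongr)

/-- The set where exact and discrete subdomains disagree. -/
def FittedMesh.mismatch {Ω : Set Plane} {Ωs : Fin 2 → Set Plane} {M : PatchMesh Ω}
    (T : FittedMesh Ωs M) : Set Plane :=
  {x | ∃ i k, i ≠ k ∧ x ∈ Ωs i ∧ x ∈ T.sub k}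

/-- A chart, together with the constant in the estimate of the discrete interface and those in the
two trace estimates. -/
lemma exists_chart_constants {Ω : Set Plane} {Ωs : Fin 2 → Set Plane}
    (hΩ : IsInterfaceSplitting Ω Ωs) {z : Plane} (hz : z ∈ interface Ωs) :
    ∃ (r : ℝ) (i : Fin 2) (j : Fin 2) (g : ℝ → ℝ) (C : ℝ) (K : NNReal), 0 < r ∧ 0 ≤ C ∧
      (∀ (M : PatchMesh Ω) (T : FittedMesh Ωs M) (p : Fin M.numPatches),
        M.meshSize ≤ 1 → M.IsCut (interface Ωs) p → M.patch p ⊆ box z r →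
        ∀ (l k : Fin 2) (x : Plane), l ≠ k → x ∈ Ωs l → x ∈ interior (M.patch p) →
          x ∈ T.part p k →
          x ∈ strip z r i j g (C * M.meshSize ^ ((if p ∈ T.linear then 1 else 2) + 1))) ∧
      (∀ (f : Plane → ℝ) (_ : MemSobolev Ω 3 f) (I : Fin 1 → Fin 2) (δ : ℝ),
        sqInt (strip z r i j g δ) (weakDeriv Ω I f) ≤
          K * ENNReal.ofReal δ * ENNReal.ofReal (sobolevNorm Ω 2 f ^ 2)) ∧
      ∀ (f : Plane → ℝ) (_ : MemSobolev Ω 3 f) (I : Fin 1 → Fin 2) (δ α h : ℝ),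
        sqInt (strip z r i j g δ ∩ {x | x i ∈ Icc (α - h) (α + h)}) (weakDeriv Ω I f) ≤
          K * (ENNReal.ofReal δ * ENNReal.ofReal h) * ENNReal.ofReal (sobolevNorm Ω 3 f ^ 2) := by
  obtain ⟨r, i, j, g, H⟩ := exists_isGraphChart hΩ.isOpen_domain hΩ.interface_subset hΩ.smooth hz
  obtain ⟨C, hC, hint⟩ := H.exists_patchInterface_bound
  obtain ⟨K₁, hK₁⟩ := H.exists_sqInt_strip_le hΩ.isOpen_domain
  obtain ⟨K₂, hK₂⟩ := H.exists_sqInt_short_strip_le hΩ.isOpen_domain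
  refine ⟨r, i, j, g, C, K₁ + K₂, H.pos, hC, ?_, ?_, ?_⟩
  · intro M T p hM hcut hbox l k x hlk hxl hxi hxk
    obtain ⟨a, b, ⟨hab, hcp, -⟩, hG⟩ := T.cut p hcut
    have ha : a ∈ interface Ωs := (hcp.symm.subset (by simp : a ∈ ({a, b} : Set Plane))).2
    have hb : b ∈ interface Ωs := (hcp.symm.subset (by simp : b ∈ ({a, b} : Set Plane))).2
    have hh0 := M.meshSize_nonneg
    have hsub : T.part p 0 ∩ T.part p 1 ⊆ M.patch p := inter_subset_left.trans (T.part_subset p 0)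
    refine T.mem_strip hΩ H hcut hbox (by positivity) ?_ hlk hxl hxi hxk
    refine hint _ (by split_ifs <;> simp) _ hh0 hM a b ha hb hab _ (hsub.trans hbox) ?_ hG
    exact fun x hx y hy => M.dist_le_meshSize (hsub hx) (hsub hy)
  · intro f hf I δ
    refine (hK₁ f hf I δ).trans ?_
    gcongr
    exact le_self_add
  · intro f hf I δ α h
    refine (hK₂ f hf I δ α h).trans ?_
    gcongr
    exact le_add_self

/-- Finitely many charts cover the compact interface. If `h` is below a Lebesgue number of the
cover, every cut patch lies in the box of one chart, and the mismatch is covered by one strip per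
chart. The number of patches along `Γ` therefore does not enter; only the linear patches are counted
one by one. -/
lemma exists_sqInt_mismatch_le_of_small {Ω : Set Plane} {Ωs : Fin 2 → Set Plane}
    (hΩ : IsInterfaceSplitting Ω Ωs) :
    ∃ (c : NNReal) (h₀ : ℝ), 0 < h₀ ∧ ∀ (M : PatchMesh Ω) (T : FittedMesh Ωs M),
      M.meshSize < h₀ → ∀ (f : Plane → ℝ) (_ : MemSobolev Ω 3 f) (I : Fin 1 → Fin 2),
      sqInt T.mismatch (weakDeriv Ω I f) ≤
        c * ENNReal.ofReal (M.meshSize ^ 2) * ENNReal.ofReal (sobolevNorm Ω 2 f ^ 2) ∧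
      sqInt T.mismatch (weakDeriv Ω I f) ≤
        c * ENNReal.ofReal (M.meshSize ^ 3) * (T.linear.card + 1) *
          ENNReal.ofReal (sobolevNorm Ω 3 f ^ 2) := by
  have hch := fun z : interface Ωs => exists_chart_constants hΩ z.2
  choose r i j g C K hr hC hstrip hK₁ hK₂ using hch
  have hcomp : IsCompact (interface Ωs) := hΩ.smooth.isCompact
  obtain ⟨t, ht⟩ := hcomp.elim_finite_subcover (fun z : interface Ωs => Metric.ball z.1 (r z))
    (fun _ => Metric.isOpen_ball)
    (fun x hx => mem_iUnion.2 ⟨⟨x, hx⟩, Metric.mem_ball_self (hr _)⟩)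
  obtain ⟨h₁, hh₁, hleb⟩ := lebesgue_number_lemma_of_metric hcomp
    (c := fun z : t => Metric.ball z.1.1 (r z)) (fun _ => Metric.isOpen_ball)
    (by
      intro x hx
      obtain ⟨z, hz, hxz⟩ := mem_iUnion₂.1 (ht hx)
      exact mem_iUnion.2 ⟨⟨z, hz⟩, hxz⟩)
  -- The bound `1` on the mesh size allows comparing different powers of `h`.
  refine ⟨∑ z ∈ t, K z * (C z).toNNReal, min h₁ 1, by positivity, ?_⟩
  intro M T hM f hf I
  set h := M.meshSize with hh
  have hh0 : 0 ≤ h := M.meshSize_nonneg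
  have hh1 : h ≤ 1 := (hM.trans_le (min_le_right _ _)).le
  have hloc : ∀ x ∈ T.mismatch, ∃ p, ∃ z ∈ t, x ∈ M.patch p ∧
      x ∈ strip z.1 (r z) (i z) (j z) (g z) (C z * h ^ ((if p ∈ T.linear then 1 else 2) + 1)) := by
    rintro x ⟨l, k, hlk, hxl, hxk⟩
    obtain ⟨p, hcut, hxi, hxp⟩ := T.exists_cut_of_mem hΩ hlk hxl hxk
    obtain ⟨y, hyi, hyΓ⟩ := hcut
    obtain ⟨z, hz⟩ := hleb y hyΓ
    have hbox : M.patch p ⊆ box z.1.1 (r z) := by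
      intro w hw
      refine closedBall_subset_box _ _ (Metric.ball_subset_closedBall (hz ?_))
      exact (M.dist_le_meshSize hw (interior_subset hyi)).trans_lt (hM.trans_le (min_le_left _ _))
    exact ⟨p, z, z.2, interior_subset hxi,
      hstrip z M T p hh1 ⟨y, hyi, hyΓ⟩ hbox l k x hlk hxl hxi hxp⟩
  set N₂ := ENNReal.ofReal (sobolevNorm Ω 2 f ^ 2)
  set N₃ := ENNReal.ofReal (sobolevNorm Ω 3 f ^ 2)
  have hN : N₂ ≤ N₃ := by
    refine ENNReal.ofReal_le_ofReal ?_
    exact pow_le_pow_left₀ (sobolevNorm_nonneg _ _ _) (sobolevNorm_mono Ω (by norm_num) f) 2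
  have hCh : ∀ z n, ENNReal.ofReal (C z * h ^ n) =
      ((C z).toNNReal : ENNReal) * ENNReal.ofReal (h ^ n) := fun z n =>
    ENNReal.ofReal_mul (hC z)
  have hsum : ∀ n, sqInt (⋃ z ∈ t, strip z.1 (r z) (i z) (j z) (g z) (C z * h ^ n))
      (weakDeriv Ω I f) ≤
      ((∑ z ∈ t, K z * (C z).toNNReal : NNReal) : ENNReal) * ENNReal.ofReal (h ^ n) * N₂ := by
    intro n
    refine (sqInt_biUnion_le _ _ _).trans ?_
    push_cast
    rw [Finset.sum_mul, Finset.sum_mul]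
    refine Finset.sum_le_sum fun z _ => (hK₁ z f hf I _).trans_eq ?_
    rw [hCh]
    ring
  constructor
  · refine (sqInt_mono ?_ _).trans (hsum 2)
    intro x hx
    obtain ⟨p, z, hz, -, hxs⟩ := hloc x hx
    refine mem_biUnion hz (strip_mono ?_ hxs)
    have := hC z
    gcongr ?_ * ?_
    exact pow_le_pow_of_le_one hh0 hh1 (by split_ifs <;> norm_num)
  -- The mismatch in a linear patch lies in a strip of width `O(h²)` and within `h` of a vertex in
  -- direction `i`, so the short-strip estimate gives `h² · h`. For the other patches the full
  -- strips of width `O(h³)` are used.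
  · set A : Fin M.numPatches → interface Ωs → Set Plane := fun p z =>
      strip z.1 (r z) (i z) (j z) (g z) (C z * h ^ 2) ∩
        {x | x (i z) ∈ Icc (M.vertex p 0 (i z) - h) (M.vertex p 0 (i z) + h)} with hA
    have hcov : T.mismatch ⊆ (⋃ z ∈ t, strip z.1 (r z) (i z) (j z) (g z) (C z * h ^ 3)) ∪
        ⋃ p ∈ T.linear, ⋃ z ∈ t, A p z := by
      intro x hx
      obtain ⟨p, z, hz, hxp, hxs⟩ := hloc x hx
      by_cases hp : p ∈ T.linear
      · rw [if_pos hp] at hxs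
        refine Or.inr (mem_biUnion hp (mem_biUnion hz ⟨hxs, ?_⟩))
        have hv : M.vertex p 0 ∈ M.patch p := subset_convexHull ℝ _ (mem_range_self 0)
        have := abs_le.1 ((abs_apply_sub_le_dist x (M.vertex p 0) (i z)).trans
          (M.dist_le_meshSize hxp hv))
        constructor <;> linarith [this.1, this.2]
      · rw [if_neg hp] at hxs
        exact Or.inl (mem_biUnion hz hxs)
    have hA2 : ∀ p, sqInt (⋃ z ∈ t, A p z) (weakDeriv Ω I f) ≤
        ((∑ z ∈ t, K z * (C z).toNNReal : NNReal) : ENNReal) * ENNReal.ofReal (h ^ 3) * N₃ := by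
      intro p
      refine (sqInt_biUnion_le _ _ _).trans ?_
      push_cast
      rw [Finset.sum_mul, Finset.sum_mul]
      refine Finset.sum_le_sum fun z _ => (hK₂ z f hf I _ _ _).trans_eq ?_
      rw [hCh, pow_succ h 2, ENNReal.ofReal_mul (by positivity)]
      ring
    set c : ENNReal := ((∑ z ∈ t, K z * (C z).toNNReal : NNReal) : ENNReal)
    calc sqInt T.mismatch (weakDeriv Ω I f)
        ≤ c * ENNReal.ofReal (h ^ 3) * N₂ +
          ∑ p ∈ T.linear, c * ENNReal.ofReal (h ^ 3) * N₃ := by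
          refine (sqInt_mono hcov _).trans ((sqInt_union_le _ _ _).trans
            (add_le_add (hsum 3) ?_))
          exact (sqInt_biUnion_le _ _ _).trans (Finset.sum_le_sum fun p _ => hA2 p)
      _ ≤ c * ENNReal.ofReal (h ^ 3) * N₃ + T.linear.card * (c * ENNReal.ofReal (h ^ 3) * N₃) := by
          rw [Finset.sum_const, nsmul_eq_mul]
          gcongr
      _ = _ := by ring

lemma FittedMesh.mismatch_subset {Ω : Set Plane} {Ωs : Fin 2 → Set Plane} {M : PatchMesh Ω}
    (T : FittedMesh Ωs M) : T.mismatch ⊆ Ω := by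
  rintro x ⟨i, k, -, -, hk⟩
  exact T.sub_subset k hk

/-- For `h ≥ h₀` the factor `(h / h₀) ^ n` is at least `1`, and the integral over the mismatch is at
most the full Sobolev norm. -/
theorem exists_sqInt_mismatch_le {Ω : Set Plane} {Ωs : Fin 2 → Set Plane}
    (hΩ : IsInterfaceSplitting Ω Ωs) :
    ∃ c : NNReal, ∀ (M : PatchMesh Ω) (T : FittedMesh Ωs M)
      (f : Plane → ℝ) (_ : MemSobolev Ω 3 f) (I : Fin 1 → Fin 2),
      sqInt T.mismatch (weakDeriv Ω I f) ≤
        c * ENNReal.ofReal (M.meshSize ^ 2) * ENNReal.ofReal (sobolevNorm Ω 2 f ^ 2) ∧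
      sqInt T.mismatch (weakDeriv Ω I f) ≤
        c * ENNReal.ofReal (M.meshSize ^ 3) * (T.linear.card + 1) *
          ENNReal.ofReal (sobolevNorm Ω 3 f ^ 2) := by
  obtain ⟨c, h₀, hh₀, hc⟩ := exists_sqInt_mismatch_le_of_small hΩ
  refine ⟨c + ((h₀⁻¹ ^ 2).toNNReal + (h₀⁻¹ ^ 3).toNNReal), fun M T f hf I => ?_⟩
  set h := M.meshSize with hh
  rcases lt_or_ge h h₀ with hlt | hge
  · obtain ⟨b1, b2⟩ := hc M T hlt f hf I
    constructor
    · refine b1.trans ?_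
      gcongr
      exact le_self_add
    · refine b2.trans ?_
      gcongr
      exact le_self_add
  · have hone : ∀ n, 1 ≤ ENNReal.ofReal (h₀⁻¹ ^ n) * ENNReal.ofReal (h ^ n) := by
      intro n
      rw [← ENNReal.ofReal_mul (by positivity), ← mul_pow, ENNReal.one_le_ofReal]
      refine one_le_pow₀ ?_
      rw [inv_mul_eq_div]
      exact (one_le_div hh₀).2 hge
    have hb : ∀ l, 1 ≤ l → l ≤ 3 → sqInt T.mismatch (weakDeriv Ω I f) ≤
        ENNReal.ofReal (sobolevNorm Ω l f ^ 2) := fun l h1 h3 =>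
      (sqInt_mono T.mismatch_subset _).trans (hf.sqInt_le hΩ.isOpen_domain h1 h3 I)
    constructor
    · refine (hb 2 (by norm_num) (by norm_num)).trans (le_mul_of_one_le_left zero_le ?_)
      refine (hone 2).trans ?_
      gcongr
      push_cast
      exact le_self_add.trans le_add_self
    · refine (hb 3 (by norm_num) le_rfl).trans (le_mul_of_one_le_left zero_le ?_)
      refine ((hone 3).trans ?_).trans (le_mul_of_one_le_right zero_le le_add_self)
      gcongr
      push_cast
      exact le_add_self.trans le_add_self

/-! ### The error of `πu` -/

namespace FittedMesh

variable {Ω : Set Plane} {Ωs : Fin 2 → Set Plane} {M : PatchMesh Ω} (T : FittedMesh Ωs M)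

lemma proj_eq (ut : Fin 2 → Plane → ℝ) {i : Fin 2} {x : Plane} (hx : x ∈ T.sub i) :
    T.proj ut x = ut i x := by
  rcases (by lia : i = 0 ∨ i = 1) with rfl | rfl
  · simp [proj, hx]
  · have : x ∉ T.sub 0 := fun h => T.disjoint_sub.le_bot ⟨h, hx⟩
    simp [proj, this]

lemma proj_ae_eq (ut : Fin 2 → Plane → ℝ) (i : Fin 2) :
    ut i =ᵐ[volume.restrict (T.sub i)] T.proj ut :=
  (ae_restrict_iff' (T.isOpen_sub i).measurableSet).2
    (Filter.Eventually.of_forall fun _ hx => (T.proj_eq ut hx).symm)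

lemma memSobolev_proj {ut : Fin 2 → Plane → ℝ} (h : ∀ i, MemSobolev Ω 3 (ut i)) :
    MemSobolev (T.sub 0 ∪ T.sub 1) 3 (T.proj ut) :=
  MemSobolev.union (T.isOpen_sub 0) (T.isOpen_sub 1) T.disjoint_sub
    (((h 0).mono (T.sub_subset 0) le_rfl).congr (T.proj_ae_eq ut 0))
    (((h 1).mono (T.sub_subset 1) le_rfl).congr (T.proj_ae_eq ut 1))

lemma memSobolev_sub_proj {u : Plane → ℝ} (hu : MemSobolev (Ωs 0 ∪ Ωs 1) 3 u)
    {ut : Fin 2 → Plane → ℝ} (h : ∀ i, MemSobolev Ω 3 (ut i)) :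
    MemSobolev T.brokenDomain 1 (u - T.proj ut) :=
  (hu.mono inter_subset_left (by norm_num)).sub
    ((T.memSobolev_proj h).mono inter_subset_right (by norm_num))

/-- Weak derivatives restrict to the four open sets `Ωs i ∩ T.sub k` and are unique there, so the
derivative of the error is `D i - D k`, which vanishes for `i = k`. The factor `4` comes from the
squared triangle inequality and from the two remaining pieces. -/
lemma sqInt_weakDeriv_sub_proj_le (hΩ : IsInterfaceSplitting Ω Ωs) {u : Plane → ℝ}
    (hu : MemSobolev (Ωs 0 ∪ Ωs 1) 3 u) {ut : Fin 2 → Plane → ℝ}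
    (h : ∀ i, MemSobolev Ω 3 (ut i))
    (heq : ∀ i, ∀ᵐ x ∂(volume.restrict (Ωs i)), ut i x = u x) (I : Fin 1 → Fin 2) :
    sqInt T.brokenDomain (weakDeriv T.brokenDomain I (u - T.proj ut)) ≤
      4 * (sqInt T.mismatch (weakDeriv Ω I (ut 0)) + sqInt T.mismatch (weakDeriv Ω I (ut 1))) := by
  set W := weakDeriv T.brokenDomain I (u - T.proj ut)
  set D := fun i => weakDeriv Ω I (ut i) with hD
  have hW : HasWeakDeriv T.brokenDomain I (u - T.proj ut) W :=
    (T.memSobolev_sub_proj hu h).hasWeakDeriv le_rfl I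
  have hop : ∀ i k, IsOpen (Ωs i ∩ T.sub k) := fun i k => (hΩ.isOpen_sub i).inter (T.isOpen_sub k)
  have hpiece : ∀ i k, sqInt (Ωs i ∩ T.sub k) W = sqInt (Ωs i ∩ T.sub k) (D i - D k) := by
    intro i k
    refine sqInt_congr ?_
    have hsub : Ωs i ∩ T.sub k ⊆ T.brokenDomain := by
      refine inter_subset_inter ?_ ?_
      · rcases (by lia : i = 0 ∨ i = 1) with rfl | rfl
        exacts [subset_union_left, subset_union_right]
      · rcases (by lia : k = 0 ∨ k = 1) with rfl | rfl
        exacts [subset_union_left, subset_union_right]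
    have hd : ∀ l, HasWeakDeriv (Ωs i ∩ T.sub k) I (ut l) (D l) := fun l =>
      ((h l).hasWeakDeriv (by norm_num) I).mono (inter_subset_right.trans (T.sub_subset k))
    refine (hW.mono hsub).unique (hop i k) (((hd i).sub (hd k)).congr ?_ .rfl)
    have e1 : ∀ᵐ x ∂(volume.restrict (Ωs i ∩ T.sub k)), ut i x = u x :=
      ae_restrict_of_ae_restrict_of_subset inter_subset_left (heq i)
    have e2 : ∀ᵐ x ∂(volume.restrict (Ωs i ∩ T.sub k)), ut k x = T.proj ut x :=
      ae_restrict_of_ae_restrict_of_subset inter_subset_right (T.proj_ae_eq ut k)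
    filter_upwards [e1, e2] with x h1 h2
    simp [h1, h2]
  have hdiag : ∀ i, sqInt (Ωs i ∩ T.sub i) W = 0 := by
    intro i
    rw [hpiece, sub_self]
    simp [sqInt]
  set S := sqInt T.mismatch (D 0) + sqInt T.mismatch (D 1) with hS
  have hoff : ∀ i k, i ≠ k → sqInt (Ωs i ∩ T.sub k) W ≤ 2 * S := by
    intro i k hik
    rw [hpiece]
    have hm : AEStronglyMeasurable (D i) (volume.restrict (Ωs i ∩ T.sub k)) :=
      (((h i).memLp hΩ.isOpen_domain (by norm_num) I).1).mono_measure
        (Measure.restrict_mono (inter_subset_left.trans (hΩ.sub_subset i)) le_rfl)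
    refine (sqInt_sub_le _ hm).trans ?_
    have hsub : Ωs i ∩ T.sub k ⊆ T.mismatch := fun x hx => ⟨i, k, hik, hx.1, hx.2⟩
    have b := fun l => sqInt_mono hsub (D l)
    rcases (by lia : (i = 0 ∧ k = 1) ∨ (i = 1 ∧ k = 0)) with ⟨rfl, rfl⟩ | ⟨rfl, rfl⟩
    · exact mul_le_mul_right (add_le_add (b 0) (b 1)) 2
    · rw [hS, add_comm (sqInt T.mismatch (D 0))]
      gcongr
      exacts [b 1, b 0]
  have hcov : T.brokenDomain ⊆ ((Ωs 0 ∩ T.sub 0) ∪ (Ωs 1 ∩ T.sub 1)) ∪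
      ((Ωs 0 ∩ T.sub 1) ∪ (Ωs 1 ∩ T.sub 0)) := by
    rintro x ⟨h1 | h1, h2 | h2⟩
    exacts [Or.inl (Or.inl ⟨h1, h2⟩), Or.inr (Or.inl ⟨h1, h2⟩), Or.inr (Or.inr ⟨h1, h2⟩),
      Or.inl (Or.inr ⟨h1, h2⟩)]
  calc sqInt T.brokenDomain W ≤ (0 + 0) + (2 * S + 2 * S) := by
        refine (sqInt_mono hcov _).trans ((sqInt_union_le _ _ _).trans (add_le_add ?_ ?_))
        · exact (sqInt_union_le _ _ _).trans (add_le_add (hdiag 0).le (hdiag 1).le)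
        · exact (sqInt_union_le _ _ _).trans (add_le_add (hoff 0 1 (by simp)) (hoff 1 0 (by simp)))
    _ = 4 * S := by ring

end FittedMesh

end InterfaceFE

end

/-! ### The error estimates: constants and square roots -/

open InterfaceFE in
theorem mainTheorem5 (Ω : Set Plane) (Ωs : Fin 2 → Set Plane)
    (hΩ : IsInterfaceSplitting Ω Ωs) (κ C : ℝ) :
    ∃ c : ℝ, ∀ M : PatchMesh Ω, M.ShapeRegular κ →
      ∀ (T : FittedMesh Ωs M) (nl : ℕ), T.linear.card ≤ nl →
      ∀ u : Plane → ℝ, MemSobolev (Ωs 0 ∪ Ωs 1) 3 u →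
      ∀ ut : Fin 2 → Plane → ℝ, IsExtension Ω Ωs C u ut →
        MemSobolev (T.sub 0 ∪ T.sub 1) 3 (T.proj ut) ∧
        MemSobolev T.brokenDomain 1 (u - T.proj ut) ∧
        sobolevSeminorm T.brokenDomain 1 (u - T.proj ut) ≤
          c * M.meshSize * (√(nl : ℝ) + 1) * sobolevNorm (Ωs 0 ∪ Ωs 1) 2 u ∧
        sobolevSeminorm T.brokenDomain 1 (u - T.proj ut) ≤
          c * M.meshSize ^ (3 / 2 : ℝ) * (√(nl : ℝ) + 1) * sobolevNorm (Ωs 0 ∪ Ωs 1) 3 u := by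
  obtain ⟨c, hc⟩ := exists_sqInt_mismatch_le hΩ
  -- `4` is the root of the factor `16` in `hsemi`; `|C|` is used because `C` may be negative.
  refine ⟨4 * √(c : ℝ) * |C|, fun M _ T nl hnl u hu ut hut => ?_⟩
  have hmem := T.memSobolev_sub_proj hu hut.mem
  refine ⟨T.memSobolev_proj hut.mem, hmem, ?_⟩
  have hopen : IsOpen T.brokenDomain := ((hΩ.isOpen_sub 0).union (hΩ.isOpen_sub 1)).inter
    ((T.isOpen_sub 0).union (T.isOpen_sub 1))
  have hh := M.meshSize_nonneg
  have hnorm : ∀ m : ℕ, m = 2 ∨ m = 3 → ∀ i,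
      sobolevNorm Ω m (ut i) ^ 2 ≤ (|C| * sobolevNorm (Ωs 0 ∪ Ωs 1) m u) ^ 2 := by
    intro m hm i
    refine pow_le_pow_left₀ (sobolevNorm_nonneg _ _ _) ((hut.bound i m hm).trans ?_) 2
    have hmu : MemSobolev (Ωs 0 ∪ Ωs 1) m u := hu.mono subset_rfl (by lia)
    refine mul_le_mul (le_abs_self C) ?_ (sobolevNorm_nonneg _ _ _) (abs_nonneg C)
    refine hmu.sobolevNorm_mono_set ((hΩ.isOpen_sub 0).union (hΩ.isOpen_sub 1))
      (hΩ.isOpen_sub i) ?_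
    rcases (by lia : i = 0 ∨ i = 1) with rfl | rfl
    exacts [subset_union_left, subset_union_right]
  -- `16 = 2 · 4 · 2`: two partial derivatives, the factor of `sqInt_weakDeriv_sub_proj_le`, and two
  -- extensions.
  have hsemi : ∀ B : ℝ, 0 ≤ B → (∀ i (I : Fin 1 → Fin 2), sqInt T.mismatch (weakDeriv Ω I (ut i)) ≤
      ENNReal.ofReal B) → sobolevSeminorm T.brokenDomain 1 (u - T.proj ut) ^ 2 ≤ 16 * B := by
    intro B hB hle
    rw [← ENNReal.ofReal_le_ofReal_iff (by positivity),
      hmem.ofReal_sobolevSeminorm_sq hopen le_rfl, ENNReal.ofReal_mul (by norm_num)]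
    calc _ ≤ ∑ _I : Fin 1 → Fin 2, 4 * (ENNReal.ofReal B + ENNReal.ofReal B) := by
          refine Finset.sum_le_sum fun I _ =>
            (T.sqInt_weakDeriv_sub_proj_le hΩ hu hut.mem hut.eq I).trans ?_
          gcongr
          exacts [hle 0 I, hle 1 I]
      _ = ENNReal.ofReal 16 * ENNReal.ofReal B := by
          simp only [Finset.sum_const, Finset.card_univ, Fintype.card_fun, Fintype.card_fin]
          rw [ENNReal.ofReal_ofNat, nsmul_eq_mul]
          push_cast
          ring
  have hcoe : (c : ENNReal) = ENNReal.ofReal c := (ENNReal.ofReal_coe_nnreal).symm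
  have hs : √(c : ℝ) ^ 2 = c := Real.sq_sqrt (NNReal.coe_nonneg c)
  have hn : √(nl : ℝ) ^ 2 = nl := Real.sq_sqrt (by positivity)
  have hn0 := Real.sqrt_nonneg (nl : ℝ)
  constructor
  · set N := sobolevNorm (Ωs 0 ∪ Ωs 1) 2 u
    have hN : 0 ≤ N := sobolevNorm_nonneg _ _ _
    have key := hsemi (c * M.meshSize ^ 2 * (|C| * N) ^ 2) (by positivity) fun i I => by
      refine (hc M T (ut i) (hut.mem i) I).1.trans ?_
      rw [ENNReal.ofReal_mul (by positivity), ENNReal.ofReal_mul (NNReal.coe_nonneg c), ← hcoe]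
      exact mul_le_mul' le_rfl (ENNReal.ofReal_le_ofReal (hnorm 2 (Or.inl rfl) i))
    refine le_of_sq_le_sq (key.trans ?_) (by positivity)
    have e : (4 * √(c : ℝ) * |C| * M.meshSize * (√(nl : ℝ) + 1) * N) ^ 2 =
        16 * (√(c : ℝ) ^ 2 * M.meshSize ^ 2 * (|C| * N) ^ 2) * (√(nl : ℝ) + 1) ^ 2 := by ring
    rw [e, hs]
    refine le_mul_of_one_le_right (by positivity) ?_
    nlinarith
  · set N := sobolevNorm (Ωs 0 ∪ Ωs 1) 3 u
    have hN : 0 ≤ N := sobolevNorm_nonneg _ _ _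
    have key := hsemi (c * M.meshSize ^ 3 * (nl + 1) * (|C| * N) ^ 2) (by positivity)
      fun i I => by
      refine (hc M T (ut i) (hut.mem i) I).2.trans ?_
      rw [ENNReal.ofReal_mul (by positivity), ENNReal.ofReal_mul (by positivity),
        ENNReal.ofReal_mul (NNReal.coe_nonneg c), ← hcoe]
      have : ENNReal.ofReal ((nl : ℝ) + 1) = nl + 1 := by
        rw [ENNReal.ofReal_add (by positivity) zero_le_one]
        simp
      rw [this]
      exact mul_le_mul' (by gcongr) (ENNReal.ofReal_le_ofReal (hnorm 3 (Or.inr rfl) i))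
    refine le_of_sq_le_sq (key.trans ?_) (by positivity)
    have hr : (M.meshSize ^ (3 / 2 : ℝ)) ^ 2 = M.meshSize ^ 3 := by
      rw [← Real.rpow_natCast, ← Real.rpow_mul hh, ← Real.rpow_natCast]
      norm_num
    have e : (4 * √(c : ℝ) * |C| * M.meshSize ^ (3 / 2 : ℝ) * (√(nl : ℝ) + 1) * N) ^ 2 =
        16 * (√(c : ℝ) ^ 2 * (M.meshSize ^ (3 / 2 : ℝ)) ^ 2 * (√(nl : ℝ) + 1) ^ 2 *
          (|C| * N) ^ 2) := by ring
    rw [e, hs, hr]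
    gcongr
    -- What remains is `nl + 1 ≤ (√nl + 1)²`.
    nlinarith
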